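/- Let $j\ge 0$ be an even integer, and let $a,b,\alpha$ be real numbers with $|a|\ge j+1$, $|b|\le 1$, $0\le\alpha\le 1$, and with $|b|<1$ if $j>0$. Write $(x)_k=x(x+1)\cdots(x+k-1)$ and $\rho_1=\frac{b-j-1+a}{4}$. Let $P^{(1)}_n$ be the monic polynomials with $P^{(1)}_{-1}=0$, $P^{(1)}_0=1$ and $$xP^{(1)}_n(x)=P^{(1)}_{n+1}(x)+(\rho_1-A_n-C_n)P^{(1)}_n(x)+u_nP^{(1)}_{n-1}(x),\qquad u_n=A_{n-1}C_n,$$ where $$A_n=\begin{cases}\frac14(n-j+a)& n\text{ even},\ n\ne j\\ \frac14\frac{(n-2j-1)(n-j+b)}{n-j}& n\text{ odd}\\ \frac12\alpha a& n=j\end{cases}\qquad C_n=\begin{cases}-\frac14\frac{n(n-j-1-b)}{n-j-1}& n\text{ even}\\ -\frac14(n-j-1-a)& n\text{ odd},\ n\ne j+1\\ \frac12(1-\alpha)a& n=j+1.\end{cases}$$ Let $P^{(0)}_n$ be the monic polynomials given by the recurrence of the same form with $A_n,C_n$ replaced by $$A^0_n=\begin{cases}-\frac14(n-j-a)& n\text{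 even},\ n\ne j\\ -\frac14\frac{(n+1)(n-j-b)}{n-j}& n\text{ odd}\\ \frac12(1-\alpha) a& n=j\end{cases}\qquad C^0_n=A_n .$$ For $0\le s\le j$ put $$x_{2s}=-(-1)^s\frac{2s-j-b+a}{4}-\frac14,\qquad x_{2s+1}=-(-1)^s\frac{2s-j-b-a}{4}-\frac14 .$$ (1) The $2j+2$ points $x_0,\dots,x_{2j+1}$ are distinct. Moreover $P^{(0)}_{2j+1}(x)=\prod_{s=0}^{2j}(x-x_s)$, $x_{2j+1}=\rho_1$ and $P^{(1)}_{2j+2}(x)=\prod_{s=0}^{2j+1}(x-x_s)$; that is, the lattice arises from the zeros of $P^{(0)}_{2j+1}$ by adding $\rho_1$. Equivalently the points form the linear quadri-lattice $x_{4s}=-\frac{4s-j-b+a}{4}-\frac14$, $x_{4s+1}=-\frac{4s-j-b-a}{4}-\frac14$ ($0\le s\le j/2$), $x_{4s+2}=\frac{4s+2-j-b+a}{4}-\frac14$, $x_{4s+3}=\frac{4s+2-j-b-a}{4}-\frac14$ ($0\le s\le j/2-1$). (2) For all $0\le n,m\le 2j+1$, $$\sum_{s=0}^{2j+1}w_s\,P^{(1)}_n(x_s)P^{(1)}_m(x_s)=u_1\cdots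 u_n\,\delta_{nm},$$ with $$w_{4s}=\frac{2\alpha\,h^*}{(-s)_s(1)_{j/2-s}(-s-\frac a2)_{j/2+1}(s+\frac{1+a-b-j}{2})_{j/2}(s+\frac{1-b-j}{2})_{j/2}},$$ $$w_{4s+1}=-\frac{2(1-\alpha)\,h^*}{(-s)_s(1)_{j/2-s}(-s+\frac a2)_{j/2+1}(s+\frac{1-a-b-j}{2})_{j/2}(s+\frac{1-b-j}{2})_{j/2}}$$ for $0\le s\le j/2$ and $$w_{4s+2}=-\frac{2\alpha\,h^*}{(-s)_s(1)_{j/2-s-1}(-s-\frac a2)_{j/2}(s+\frac{1+a-b-j}{2})_{j/2+1}(s+\frac{1-b-j}{2})_{j/2+1}},$$ $$w_{4s+3}=\frac{2(1-\alpha)\,h^*}{(-s)_s(1)_{j/2-s-1}(-s+\frac a2)_{j/2}(s+\frac{1-a-b-j}{2})_{j/2+1}(s+\frac{1-b-j}{2})_{j/2+1}}$$ for $0\le s\le j/2-1$, where all denominators are nonzero and $$h^*=\frac{(1)_j\,(\frac{1-b-j}{2})_j\,(-\frac{j+a}{2})_{j+1}}{2^{2j+1}(\frac{1-j}{2})_j},\qquad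 (h^*)^2=u_1\cdots u_{2j+1}\big|_{\alpha=1/2}.$$ (3) For $0\le n\le 2j+1$ one has $u_1\cdots u_n=h_n^2$, where, for $0\le n\le j$, $$h_{2n}=\frac{\sqrt{(-j)_n(1)_n(\frac{1-b-j}{2})_n(\frac{1+b-j}{2})_n(-\frac{j+a}{2})_n(-\frac{j-a}{2})_n}}{2^{2n}(\frac{1-j}{2})_n}\times\begin{cases}1&n\le j/2\\2\sqrt{\alpha(1-\alpha)}&n>j/2,\end{cases}$$ $$h_{2n+1}=\frac{\sqrt{-(-j)_n(1)_n(\frac{1-b-j}{2})_n(\frac{1+b-j}{2})_n(-\frac{j+a}{2})_{n+1}(-\frac{j-a}{2})_{n+1}}}{2^{2n+1}(\frac{1-j}{2})_n}\times\begin{cases}1&n<j/2\\2\sqrt{\alpha(1-\alpha)}&n\ge j/2.\end{cases}$$ (4) If $0<\alpha<1$, then $u_n>0$ for $1\le n\le 2j+1$, and for $0\le s\le 2j+1$ the number $P^{(1)}_{2j+1}(x_s)\,P^{(1)\prime}_{2j+2}(x_s)$ is nonzero and $$w_s=\frac{u_1\cdots u_{2j+1}}{P^{(1)}_{2j+1}(x_s)\,P^{(1)\prime}_{2j+2}(x_s)}>0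 .$$ -/

import Mathlib

namespace ParaBannaiIto

/-- The Pochhammer symbol `x (x + 1) ⋯ (x + k - 1)`. -/
noncomputable def poch (x : ℝ) (k : ℕ) : ℝ := (ascPochhammer ℝ k).eval x

/-- The parameter `ρ₁ = (b - j - 1 + a) / 4`. -/
noncomputable def rho1 (j : ℕ) (a b : ℝ) : ℝ := (b - j - 1 + a) / 4

/-- The monic polynomials with three-term recurrence
`x P_n = P_{n+1} + (r - A_n - C_n) P_n + A_{n-1} C_n P_{n-1}`, `P_{-1} = 0`, `P_0 = 1`. -/
noncomputable def recPoly (r : ℝ) (A C : ℕ → ℝ) : ℕ → Polynomial ℝ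
  | 0 => 1
  | 1 => Polynomial.X - Polynomial.C (r - A 0 - C 0)
  | n + 2 =>
      (Polynomial.X - Polynomial.C (r - A (n + 1) - C (n + 1))) * recPoly r A C (n + 1)
        - Polynomial.C (A n * C (n + 1)) * recPoly r A C n

/-! Recurrence coefficients and polynomials for `N = 2j`, `j` even. -/

noncomputable def coeffA0 (j : ℕ) (a b α : ℝ) (n : ℕ) : ℝ :=
  if Even n then
    if n = j then (1 / 2) * (1 - α) * a
    else -(1 / 4) * ((n : ℝ) - j - a)
  else -(1 / 4) * ((((n : ℝ) + 1) * ((n : ℝ) - j - b)) / ((n : ℝ) - j))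

noncomputable def coeffC0 (j : ℕ) (a b α : ℝ) (n : ℕ) : ℝ :=
  if Even n then
    if n = j then (1 / 2) * α * a
    else (1 / 4) * ((n : ℝ) - j + a)
  else (1 / 4) * ((((n : ℝ) - 2 * j - 1) * ((n : ℝ) - j + b)) / ((n : ℝ) - j))

/-- The para-Bannai-Ito polynomials for `N = 2j`, `j` even. -/
noncomputable def P0 (j : ℕ) (a b α : ℝ) (n : ℕ) : Polynomial ℝ :=
  recPoly (rho1 j a b) (coeffA0 j a b α) (coeffC0 j a b α) n

/-! Recurrence coefficients and polynomials for `N = 2j + 1`, `j` even. -/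

noncomputable def coeffA1 (j : ℕ) (a b α : ℝ) (n : ℕ) : ℝ :=
  if Even n then
    if n = j then (1 / 2) * α * a
    else (1 / 4) * ((n : ℝ) - j + a)
  else (1 / 4) * ((((n : ℝ) - 2 * j - 1) * ((n : ℝ) - j + b)) / ((n : ℝ) - j))

noncomputable def coeffC1 (j : ℕ) (a b α : ℝ) (n : ℕ) : ℝ :=
  if Even n then -(1 / 4) * (((n : ℝ) * ((n : ℝ) - j - 1 - b)) / ((n : ℝ) - j - 1))
  else if n = j + 1 then (1 / 2) * (1 - α) * a
  else -(1 / 4) * ((n : ℝ) - j - 1 - a)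

/-- The para-Bannai-Ito polynomials for `N = 2j + 1`, `j` even. -/
noncomputable def P1 (j : ℕ) (a b α : ℝ) (n : ℕ) : Polynomial ℝ :=
  recPoly (rho1 j a b) (coeffA1 j a b α) (coeffC1 j a b α) n

/-- `u_n = A_{n-1} C_n`, used for `n ≥ 1`. -/
noncomputable def u (j : ℕ) (a b α : ℝ) (n : ℕ) : ℝ :=
  coeffA1 j a b α (n - 1) * coeffC1 j a b α n

/-- The product `u_1 ⋯ u_n`. -/
noncomputable def uProd (j : ℕ) (a b α : ℝ) (n : ℕ) : ℝ :=
  ∏ i ∈ Finset.Icc 1 n, u j a b α i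

/-- The Bannai-Ito bi-lattice: `x_{2s} = -(-1)^s (2s-j-b+a)/4 - 1/4` and
`x_{2s+1} = -(-1)^s (2s-j-b-a)/4 - 1/4`. -/
noncomputable def grid (j : ℕ) (a b : ℝ) (k : ℕ) : ℝ :=
  if Even k then -(-1) ^ (k / 2) * ((2 * ((k / 2 : ℕ) : ℝ) - j - b + a) / 4) - 1 / 4
  else -(-1) ^ (k / 2) * ((2 * ((k / 2 : ℕ) : ℝ) - j - b - a) / 4) - 1 / 4

/-- The `α`-independent constant `h_{2j+1}` that appears in the weights. -/
noncomputable def hTop (j : ℕ) (a b : ℝ) : ℝ :=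
  poch 1 j * poch ((1 - b - j) / 2) j * poch (-((j + a) / 2)) (j + 1) /
    (2 ^ (2 * j + 1) * poch ((1 - j) / 2) j)

/-! The weights `w_{4s}`, `w_{4s+1}`, `w_{4s+2}`, `w_{4s+3}`. -/

noncomputable def weight0 (j : ℕ) (a b α : ℝ) (s : ℕ) : ℝ :=
  2 * α * hTop j a b /
    (poch (-s) s * poch 1 (j / 2 - s) * poch (-s - a / 2) (j / 2 + 1) *
      poch (s + (1 + a - b - j) / 2) (j / 2) * poch (s + (1 - b - j) / 2) (j / 2))

noncomputable def weight1 (j : ℕ) (a b α : ℝ) (s : ℕ) : ℝ :=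
  -(2 * (1 - α) * hTop j a b /
    (poch (-s) s * poch 1 (j / 2 - s) * poch (-s + a / 2) (j / 2 + 1) *
      poch (s + (1 - a - b - j) / 2) (j / 2) * poch (s + (1 - b - j) / 2) (j / 2)))

noncomputable def weight2 (j : ℕ) (a b α : ℝ) (s : ℕ) : ℝ :=
  -(2 * α * hTop j a b /
    (poch (-s) s * poch 1 (j / 2 - s - 1) * poch (-s - a / 2) (j / 2) *
      poch (s + (1 + a - b - j) / 2) (j / 2 + 1) * poch (s + (1 - b - j) / 2) (j / 2 + 1)))

noncomputable def weight3 (j : ℕ) (a b α : ℝ) (s : ℕ) : ℝ :=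
  2 * (1 - α) * hTop j a b /
    (poch (-s) s * poch 1 (j / 2 - s - 1) * poch (-s + a / 2) (j / 2) *
      poch (s + (1 - a - b - j) / 2) (j / 2 + 1) * poch (s + (1 - b - j) / 2) (j / 2 + 1))

/-- The weight `w_k`, for `k = 4s + i` with `0 ≤ i ≤ 3`. -/
noncomputable def weight (j : ℕ) (a b α : ℝ) (k : ℕ) : ℝ :=
  if k % 4 = 0 then weight0 j a b α (k / 4)
  else if k % 4 = 1 then weight1 j a b α (k / 4)
  else if k % 4 = 2 then weight2 j a b α (k / 4)
  else weight3 j a b α (k / 4)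

/-- The explicit `h_{2n}`. -/
noncomputable def hEven (j : ℕ) (a b α : ℝ) (n : ℕ) : ℝ :=
  √(poch (-j) n * poch 1 n * poch ((1 - b - j) / 2) n * poch ((1 + b - j) / 2) n *
      poch (-((j + a) / 2)) n * poch (-((j - a) / 2)) n) /
    (2 ^ (2 * n) * poch ((1 - j) / 2) n) *
  (if n ≤ j / 2 then 1 else 2 * √(α * (1 - α)))

/-- The explicit `h_{2n+1}`. -/
noncomputable def hOdd (j : ℕ) (a b α : ℝ) (n : ℕ) : ℝ :=
  √((-1) * poch (-j) n * poch 1 n * poch ((1 - b - j) / 2) n * poch ((1 + b - j) / 2) n *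
      poch (-((j + a) / 2)) (n + 1) * poch (-((j - a) / 2)) (n + 1)) /
    (2 ^ (2 * n + 1) * poch ((1 - j) / 2) n) *
  (if n < j / 2 then 1 else 2 * √(α * (1 - α)))

/-- The explicit `h_n`. -/
noncomputable def hNorm (j : ℕ) (a b α : ℝ) (n : ℕ) : ℝ :=
  if Even n then hEven j a b α (n / 2) else hOdd j a b α (n / 2)

end ParaBannaiIto

namespace ParaBannaiIto

open Polynomial Finset

/-! ### Polynomials given by a three-term recurrence -/

section Recurrence

variable {r : ℝ} {A C A' C' : ℕ → ℝ}

/-! Write `j = 2h`, `N = 2j + 1`, `c = a/2`. The proof rests on a reflection. Reading the Jacobi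
matrix of `P1` backwards interchanges `A` and `C` and replaces `α` by `1 - α` (`coeffA1_mirror`,
`coeffC1_mirror`).

Factorization. Cutting the determinant in the middle (`recPoly_mirror`) expresses `P1` of degree `N
+ 1` through degrees `j` and `j + 1` for `α` and `1 - α`. Let `P` be the polynomial of degree `j`,
which is free of `α`, and `T` the one of degree `j + 1` at `α = 0`. Then degree `j + 1` at `α` is `T
+ α c P`, and the cut gives `(T + α c P)(T + (1 - α) c P) - α(1 - α) c² P² = T (T + c P)`,
independent of `α`. Below the middle the coefficients are even in `a`, so `T + c P` is `T` with `a`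
replaced by `-a`. It remains to find the roots of `T`. By the kernel identity `X_sub_C_mul_recPoly`,
`T` is `X - ρ₁` times `P0` of degree `j`. The expansion of `P0` in products of `X² - (ρ₁ + i)²`
(`P0_expansion`) reduces to a single term in degree `j`, so all roots are explicit.

Weights. At a root `x` of degree `N + 1`, solving the recurrence from either end gives proportional
vectors (`eval_recPoly_mul_mirror`). Hence the mirrored polynomial of degree `N` divided by the
derivative of the top polynomial is a weight: orthogonality becomes the formula for the leading
coefficient of a Lagrange interpolant (`sum_recPoly_mul_recPoly`). This form avoids dividing by `P1`
of degree `N`, so it also covers `α = 0` and `α = 1`. Comparing the two ends at degree `j` shows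
that the mirrored polynomial takes one value on the roots of `T` and another on those of `T + c P`.
These are the numerators; the derivatives are the Pochhammer denominators, whose nonvanishing also
makes the nodes distinct.

Norms come from a telescoping product in which `α` enters only through `u` at `j + 1`. Positivity of
the weights follows from orthogonality and positivity of the norms. -/

theorem recPoly_zero : recPoly r A C 0 = 1 := by rw [recPoly]

theorem recPoly_one : recPoly r A C 1 = X - Polynomial.C (r - A 0 - C 0) := by rw [recPoly]

theorem recPoly_add_two (n : ℕ) :
    recPoly r A C (n + 2) =
      (X - Polynomial.C (r - A (n + 1) - C (n + 1))) * recPoly r A C (n + 1)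
        - Polynomial.C (A n * C (n + 1)) * recPoly r A C n := by
  rw [recPoly]

theorem recPoly_monic_natDegree (n : ℕ) :
    (recPoly r A C n).Monic ∧ (recPoly r A C n).natDegree = n := by
  induction n using Nat.twoStepInduction with
  | zero => simp [recPoly_zero]
  | one => rw [recPoly_one]; exact ⟨monic_X_sub_C _, natDegree_X_sub_C _⟩
  | more n ih₀ ih₁ =>
    have hm : ((X - Polynomial.C (r - A (n + 1) - C (n + 1))) * recPoly r A C (n + 1)).Monic :=
      (monic_X_sub_C _).mul ih₁.1
    have hd : ((X - Polynomial.C (r - A (n + 1) - C (n + 1))) *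
        recPoly r A C (n + 1)).natDegree = n + 2 := by
      rw [(monic_X_sub_C _).natDegree_mul ih₁.1, natDegree_X_sub_C, ih₁.2]; ring
    have hlt : (Polynomial.C (A n * C (n + 1)) * recPoly r A C n).degree <
        ((X - Polynomial.C (r - A (n + 1) - C (n + 1))) * recPoly r A C (n + 1)).degree := by
      rw [degree_eq_natDegree hm.ne_zero, hd]
      refine lt_of_le_of_lt degree_le_natDegree ?_
      have := natDegree_C_mul_le (A n * C (n + 1)) (recPoly r A C n)
      rw [ih₀.2] at this
      exact_mod_cast (by omega : _ < n + 2)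
    rw [recPoly_add_two]
    refine ⟨hm.sub_of_left hlt, ?_⟩
    rw [natDegree_sub_eq_left_of_natDegree_lt, hd]
    rw [hd]
    have := natDegree_C_mul_le (A n * C (n + 1)) (recPoly r A C n)
    omega

theorem recPoly_monic (n : ℕ) : (recPoly r A C n).Monic := (recPoly_monic_natDegree n).1

theorem natDegree_recPoly (n : ℕ) : (recPoly r A C n).natDegree = n :=
  (recPoly_monic_natDegree n).2

/-- Only the recurrence coefficients below `n` enter the `n`-th polynomial. -/
theorem recPoly_congr {r' : ℝ} {N : ℕ}
    (hd : ∀ i < N, r - A i - C i = r' - A' i - C' i)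
    (hu : ∀ i, i + 1 < N → A i * C (i + 1) = A' i * C' (i + 1)) :
    ∀ n ≤ N, recPoly r A C n = recPoly r' A' C' n := by
  intro n
  induction n using Nat.twoStepInduction with
  | zero => simp [recPoly_zero]
  | one => intro h; rw [recPoly_one, recPoly_one, hd 0 (by omega)]
  | more n ih₀ ih₁ =>
    intro h
    rw [recPoly_add_two, recPoly_add_two, ih₀ (by omega), ih₁ (by omega), hd (n + 1) (by omega),
      hu n (by omega)]

/-- Kernel polynomials at the point `r`. -/
theorem X_sub_C_mul_recPoly (hC : C 0 = 0) (n : ℕ) :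
    (X - Polynomial.C r) * recPoly r (fun i => C (i + 1)) A n =
      recPoly r A C (n + 1) - Polynomial.C (A n) * recPoly r A C n := by
  induction n using Nat.twoStepInduction with
  | zero => rw [recPoly_zero, recPoly_zero, recPoly_one, hC]; simp only [map_sub, map_zero]; ring
  | one =>
    rw [recPoly_add_two, recPoly_one, recPoly_one, recPoly_zero, hC]
    simp only [map_sub, map_zero, map_mul, zero_add]; ring
  | more n ih₀ ih₁ =>
    rw [recPoly_add_two]
    have e : (X - Polynomial.C r) *
        ((X - Polynomial.C (r - C (n + 1 + 1) - A (n + 1))) *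
          recPoly r (fun i => C (i + 1)) A (n + 1) -
          Polynomial.C (C (n + 1) * A (n + 1)) * recPoly r (fun i => C (i + 1)) A n) =
        (X - Polynomial.C (r - C (n + 1 + 1) - A (n + 1))) *
          ((X - Polynomial.C r) * recPoly r (fun i => C (i + 1)) A (n + 1)) -
        Polynomial.C (C (n + 1) * A (n + 1)) *
          ((X - Polynomial.C r) * recPoly r (fun i => C (i + 1)) A n) := by ring
    rw [e, ih₀, ih₁, recPoly_add_two (n + 1), recPoly_add_two n]
    simp only [map_sub, map_mul]; ring

/-- Gluing of a recurrence with its mirror image. -/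
theorem recPoly_mirror {N : ℕ} (hA : ∀ n m, n + m = N → A' m = C n)
    (hC : ∀ n m, n + m = N → C' m = A n) (m : ℕ) : ∀ n, n + m + 1 = N →
    recPoly r A C (N + 1) =
      recPoly r A C (n + 1) * recPoly r A' C' (m + 1) -
        Polynomial.C (A n * C (n + 1)) * (recPoly r A C n * recPoly r A' C' m) := by
  -- This is the expansion of the Jacobi determinant along a cut between `n` and `n + 1`; with `m =
  -- 0` it is the recurrence itself, and the induction moves the cut by one place.
  induction m with
  | zero =>
    rintro n rfl
    rw [recPoly_add_two, recPoly_zero, recPoly_one, hA (n + 1) 0 (by omega),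
      hC (n + 1) 0 (by omega)]
    simp only [map_sub, map_mul]; ring
  | succ m ih =>
    rintro n h
    rw [ih (n + 1) (by omega), recPoly_add_two n, recPoly_add_two m, hA (n + 1) (m + 1) (by omega),
      hC (n + 1) (m + 1) (by omega), hA (n + 2) m (by omega)]
    simp only [map_sub, map_mul]; ring

/-- At an eigenvalue the eigenvector is proportional to the one computed from the other end. -/
theorem eval_recPoly_mul_mirror {N : ℕ} (hA : ∀ n m, n + m = N → A' m = C n)
    (hC : ∀ n m, n + m = N → C' m = A n) {x : ℝ} (hx : (recPoly r A C (N + 1)).eval x = 0)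
    (n : ℕ) : ∀ m, n + m = N →
      (recPoly r A C n).eval x * (recPoly r A' C' N).eval x =
        (∏ i ∈ range n, A i * C (i + 1)) * (recPoly r A' C' m).eval x := by
  induction n using Nat.twoStepInduction with
  | zero => rintro m h; simp [recPoly_zero, ← h]
  | one =>
    rintro m h
    obtain rfl : N = m + 1 := by omega
    -- Cutting after the first row turns the vanishing at `x` into the case `n = 1`; beyond it both
    -- sides obey the same recurrence.
    rw [recPoly_mirror hA hC m 0 (by omega)] at hx
    simp only [recPoly_zero, eval_sub, eval_mul, eval_C, eval_one, zero_add] at hx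
    simp only [prod_range_one, zero_add]
    linarith
  | more n ih₀ ih₁ =>
    rintro m h
    have h₀ := ih₀ (m + 2) (by omega)
    have h₁ := ih₁ (m + 1) (by omega)
    rw [recPoly_add_two m, hA (n + 1) (m + 1) (by omega), hC (n + 1) (m + 1) (by omega),
      hA (n + 2) m (by omega)] at h₀
    rw [recPoly_add_two n, prod_range_succ, prod_range_succ]
    rw [prod_range_succ] at h₁
    simp only [eval_sub, eval_mul, eval_C, eval_X] at h₀ h₁ ⊢
    linear_combination (x - (r - A (n + 1) - C (n + 1))) * h₁ - A n * C (n + 1) * h₀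

end Recurrence

/-! ### Gauss-type quadrature -/

/-- Both sides are the coefficient of degree `N` of the Lagrange interpolant of `p` at the nodes,
which is `p` itself. -/
theorem sum_eval_div_derivative_nodal {N : ℕ} {x : ℕ → ℝ} (hx : Set.InjOn x (range (N + 1)))
    {W : ℝ[X]} (hW : W = ∏ s ∈ range (N + 1), (X - Polynomial.C (x s))) {p : ℝ[X]}
    (hp : p.natDegree ≤ N) :
    ∑ s ∈ range (N + 1), p.eval (x s) / (derivative W).eval (x s) = p.coeff N := by
  have hd : p.degree < #(range (N + 1)) := by
    rw [card_range]
    exact lt_of_le_of_lt degree_le_natDegree (by exact_mod_cast Nat.lt_succ_of_le hp)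
  have := Lagrange.coeff_eq_sum hx hd
  rw [card_range, Nat.add_sub_cancel] at this
  rw [this]
  refine sum_congr rfl fun s hs => ?_
  rw [hW, ← Lagrange.nodal_eq, Lagrange.eval_nodal_derivative_eval_node_eq hs, Lagrange.eval_nodal]

/-- Orthogonality with the weights read off from the mirrored recurrence. -/
theorem sum_recPoly_mul_recPoly {r : ℝ} {A C A' C' : ℕ → ℝ} {N : ℕ}
    (hA : ∀ n m, n + m = N → A' m = C n) (hC : ∀ n m, n + m = N → C' m = A n)
    {x w : ℕ → ℝ} (hx : Set.InjOn x (range (N + 1)))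
    (hW : recPoly r A C (N + 1) = ∏ s ∈ range (N + 1), (X - Polynomial.C (x s)))
    (hw : ∀ s < N + 1, w s = (recPoly r A' C' N).eval (x s) /
      (derivative (recPoly r A C (N + 1))).eval (x s))
    {n m : ℕ} (hn : n ≤ N) (hm : m ≤ N) :
    ∑ s ∈ range (N + 1), w s * (recPoly r A C n).eval (x s) * (recPoly r A C m).eval (x s) =
      if n = m then ∏ i ∈ range n, A i * C (i + 1) else 0 := by
  wlog hmn : m ≤ n generalizing n m
  · have := this hm hn (by omega)
    rw [if_neg (by omega)] at this ⊢
    rw [← this]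
    exact sum_congr rfl fun s _ => by ring
  obtain ⟨k, rfl⟩ := Nat.exists_eq_add_of_le hn
  -- The larger index `n` is traded for the mirrored polynomial of degree `k = N - n`. The product
  -- then has degree `k + m ≤ N`, with equality exactly when `m = n`.
  have hterm : ∀ s ∈ range (n + k + 1),
      w s * (recPoly r A C n).eval (x s) * (recPoly r A C m).eval (x s) =
        (∏ i ∈ range n, A i * C (i + 1)) * ((recPoly r A' C' k * recPoly r A C m).eval (x s) /
          (derivative (recPoly r A C (n + k + 1))).eval (x s)) := by
    intro s hs
    have h0 : (recPoly r A C (n + k + 1)).eval (x s) = 0 := by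
      rw [hW, ← Lagrange.nodal_eq, Lagrange.eval_nodal_at_node hs]
    have := eval_recPoly_mul_mirror hA hC h0 n k rfl
    rw [hw s (mem_range.1 hs), eval_mul]
    linear_combination (recPoly r A C m).eval (x s) /
      (derivative (recPoly r A C (n + k + 1))).eval (x s) * this
  have hmon := (recPoly_monic (r := r) (A := A') (C := C') k).mul
    (recPoly_monic (r := r) (A := A) (C := C) m)
  have hdeg : (recPoly r A' C' k * recPoly r A C m).natDegree = k + m := by
    rw [(recPoly_monic k).natDegree_mul (recPoly_monic m), natDegree_recPoly, natDegree_recPoly]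
  rw [sum_congr rfl hterm, ← mul_sum, sum_eval_div_derivative_nodal hx hW (by omega)]
  split_ifs with h
  · subst h
    rw [add_comm n k, ← hdeg, hmon.coeff_natDegree, mul_one]
  · rw [coeff_eq_zero_of_natDegree_lt (by omega), mul_zero]

/-- A weight for which finitely many polynomials, as many as there are points, are orthogonal with
positive norms is positive. -/
theorem weight_pos_of_orthogonal {K : ℕ} {w c : ℕ → ℝ} {p : ℕ → ℕ → ℝ} (hc : ∀ n < K, 0 < c n)
    (ho : ∀ n m, n < K → m < K →
      ∑ s ∈ range K, w s * p n s * p m s = if n = m then c n else 0) :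
    ∀ s < K, 0 < w s := by
  intro s hs
  let M : Matrix (Fin K) (Fin K) ℝ := fun n s => p n s
  let L : Matrix (Fin K) (Fin K) ℝ := fun s n => w s * p n s / c n
  have h1 : M * L = 1 := by
    ext n m
    rw [Matrix.mul_apply, Matrix.one_apply]
    have := ho n m n.2 m.2
    rw [← Fin.sum_univ_eq_sum_range (fun s => w s * p n s * p m s)] at this
    have h2 : ∑ s : Fin K, M n s * L s m = (∑ s : Fin K, w s * p n s * p m s) / c m := by
      rw [sum_div]
      exact sum_congr rfl fun s _ => by simp only [M, L]; ring
    rw [h2, this]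
    by_cases hnm : n = m
    · subst hnm; simp [(hc n n.2).ne']
    · have : (n : ℕ) ≠ m := fun h => hnm (Fin.ext h)
      simp [this, hnm]
  -- A one-sided inverse of a square matrix is two-sided, so orthogonality in the degree gives dual
  -- orthogonality over the nodes; its diagonal entry is `w s` times a nonnegative sum, equal to
  -- `1`.
  have h1' : L * M = 1 := mul_eq_one_comm.1 h1
  have h2 := congrFun (congrFun h1' ⟨s, hs⟩) ⟨s, hs⟩
  rw [Matrix.mul_apply, Matrix.one_apply, if_pos rfl] at h2
  have h3 : w s * ∑ n : Fin K, p n s ^ 2 / c n = 1 := by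
    rw [← h2, mul_sum]
    exact sum_congr rfl fun n _ => by simp only [M, L]; ring
  have h4 : 0 ≤ ∑ n : Fin K, p n s ^ 2 / c n :=
    sum_nonneg fun n _ => div_nonneg (sq_nonneg _) (hc n n.2).le
  by_contra hneg
  have := mul_nonpos_of_nonpos_of_nonneg (not_lt.1 hneg) h4
  linarith

/-! ### Expansion of the complementary Bannai-Ito polynomials -/

theorem prod_Ico_shift (f : ℕ → ℝ) {k n : ℕ} (hkn : k ≤ n) :
    (∏ i ∈ Ico k n, f (i + 1)) * f k = (∏ i ∈ Ico k n, f i) * f n := by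
  induction n, hkn using Nat.le_induction with
  | base => simp
  | succ n hn ih =>
    rw [prod_Ico_succ_top hn, prod_Ico_succ_top hn]
    linear_combination f (n + 1) * ih

/-- Coefficients of the polynomials of even degree. -/
noncomputable def evenCoeff (h : ℕ) (a b : ℝ) (n k : ℕ) : ℝ :=
  n.choose k * ((∏ i ∈ Ico k n, ((1 - 2 * h + b) / 2 + i)) *
    (∏ i ∈ Ico k n, -(((2 - 2 * h + a) / 2 + i) * (1 - h + i))) /
    ∏ i ∈ Ico k n, ((2 * h : ℝ) - n - i))

/-- Coefficients of the polynomials of odd degree. -/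
noncomputable def oddCoeff (h : ℕ) (a b : ℝ) (n k : ℕ) : ℝ :=
  n.choose k * ((∏ i ∈ Ico k n, ((1 - 2 * h + b) / 2 + (i + 1 : ℕ))) *
    (∏ i ∈ Ico k n, -(((2 - 2 * h + a) / 2 + i) * (1 - h + i))) /
    ∏ i ∈ Ico k n, ((2 * h : ℝ) - n - (i + 1 : ℕ)))

variable {h : ℕ} {a b : ℝ}

theorem evenCoeff_self (n : ℕ) : evenCoeff h a b n n = 1 := by simp [evenCoeff]

theorem oddCoeff_self (n : ℕ) : oddCoeff h a b n n = 1 := by simp [oddCoeff]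

theorem oddCoeff_of_lt {n k : ℕ} (hnk : n < k) : oddCoeff h a b n k = 0 := by
  simp [oddCoeff, Nat.choose_eq_zero_of_lt hnk]

theorem evenCoeff_of_lt {n k : ℕ} (hnk : n < k) : evenCoeff h a b n k = 0 := by
  simp [evenCoeff, Nat.choose_eq_zero_of_lt hnk]

/-- The factor `1 - h + i` vanishes at `i = h - 1`, which lies in every range `Ico k h` with `k <
h`. This is why the expansion truncates in the middle degree. -/
theorem evenCoeff_top {k : ℕ} (hk : k < h) : evenCoeff h a b h k = 0 := by
  have : ∏ i ∈ Ico k h, -(((2 - 2 * (h : ℝ) + a) / 2 + i) * (1 - h + i)) = 0 := by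
    refine prod_eq_zero (i := h - 1) (mem_Ico.2 ⟨by omega, by omega⟩) ?_
    rw [Nat.cast_sub (by omega)]; push_cast; ring
  rw [evenCoeff, this]; ring

theorem prod_sub_ne_zero {n k : ℕ} {t : ℝ} (ht : (n : ℝ) < t + 1) :
    ∏ i ∈ Ico k n, (t - i) ≠ 0 := by
  rw [prod_ne_zero_iff]
  intro i hi
  have h1 : (i : ℝ) + 1 ≤ n := by exact_mod_cast (mem_Ico.1 hi).2
  linarith

section Ratios

variable {n k : ℕ} (hb : ∀ i < h, (1 - 2 * (h : ℝ) + b) / 2 + i ≠ 0)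

-- The ratio lemmas of this section express neighbouring coefficients as rational multiples of one
-- of them, so that each coefficient recurrence becomes a single rational identity.
include hb in
theorem oddCoeff_eq (hn : n < h) (hk : k ≤ n) :
    oddCoeff h a b n k = evenCoeff h a b n k *
      (((1 - 2 * h + b) / 2 + n) * (2 * h - n - k) /
        (((1 - 2 * h + b) / 2 + k) * (2 * h - 2 * n))) := by
  have hn' : (n : ℝ) + 1 ≤ h := by exact_mod_cast hn
  have hk' : (k : ℝ) ≤ n := by exact_mod_cast hk
  have e1 := prod_Ico_shift (fun i => (1 - 2 * (h : ℝ) + b) / 2 + i) hk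
  have e2 := prod_Ico_shift (fun i => (2 * h : ℝ) - n - i) hk
  have d1 : ∏ i ∈ Ico k n, ((2 * h : ℝ) - n - i) ≠ 0 := prod_sub_ne_zero (by linarith)
  have d2 : ∏ i ∈ Ico k n, ((2 * h : ℝ) - n - (i + 1 : ℕ)) ≠ 0 := by
    rw [prod_ne_zero_iff]
    intro i hi
    have h1 : (i : ℝ) + 1 ≤ n := by exact_mod_cast (mem_Ico.1 hi).2
    push_cast
    linarith
  have d3 : (2 * h : ℝ) - 2 * n ≠ 0 := by linarith
  have d4 : (2 * h : ℝ) - n - k ≠ 0 := by linarith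
  have d5 := hb k (by omega)
  rw [oddCoeff, evenCoeff]
  beta_reduce at e1 e2
  generalize ∏ i ∈ Ico k n, ((1 - 2 * (h : ℝ) + b) / 2 + (i + 1 : ℕ)) = x1 at *
  generalize ∏ i ∈ Ico k n, ((1 - 2 * (h : ℝ) + b) / 2 + (i : ℕ)) = y1 at *
  generalize ∏ i ∈ Ico k n, ((2 * h : ℝ) - n - (i + 1 : ℕ)) = x2 at *
  generalize ∏ i ∈ Ico k n, ((2 * h : ℝ) - n - i) = y2 at *
  generalize ∏ i ∈ Ico k n, -(((2 - 2 * (h : ℝ) + a) / 2 + i) * (1 - h + i)) = z at *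
  generalize (1 - 2 * (h : ℝ) + b) / 2 = p at *
  have f1 : x1 = y1 * (p + n) / (p + k) := by rw [eq_div_iff d5, e1]
  have f2 : x2 = y2 * (2 * h - 2 * n) / (2 * h - n - k) := by
    rw [eq_div_iff d4, e2]; ring
  rw [f1, f2]
  field_simp

include hb in
theorem oddCoeff_pred (ha : ∀ i < h, (2 - 2 * (h : ℝ) + a) / 2 + i ≠ 0) (hn : n + 1 < h)
    (hk : k ≤ n) :
    oddCoeff h a b n k = -(evenCoeff h a b (n + 1) k *
      ((n + 1 - k) * (2 * h - 2 * n - 1) /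
        ((n + 1) * ((1 - 2 * h + b) / 2 + k) * ((2 - 2 * h + a) / 2 + n) * (1 - h + n)))) := by
  have hn' : (n : ℝ) + 2 ≤ h := by exact_mod_cast hn
  have hk' : (k : ℝ) ≤ n := by exact_mod_cast hk
  have e1 := prod_Ico_shift (fun i => (1 - 2 * (h : ℝ) + b) / 2 + i) hk
  have e2 : ∏ i ∈ Ico k n, ((2 * h : ℝ) - n - (i + 1 : ℕ)) =
      ∏ i ∈ Ico k n, ((2 * h : ℝ) - (n + 1 : ℕ) - i) :=
    prod_congr rfl fun i _ => by push_cast; ring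
  have d1 : ∏ i ∈ Ico k n, ((2 * h : ℝ) - (n + 1 : ℕ) - i) ≠ 0 :=
    prod_sub_ne_zero (by push_cast; linarith)
  have d3 : (2 * h : ℝ) - 2 * n - 1 ≠ 0 := by linarith
  have d4 : (1 : ℝ) - h + n ≠ 0 := by linarith
  have d5 := hb k (by omega)
  have d6 := ha n (by omega)
  have d7 : (n : ℝ) + 1 ≠ 0 := by positivity
  have ec : ((n + 1).choose k : ℝ) * (n + 1 - k) = n.choose k * (n + 1) := by
    have := Nat.choose_mul_succ_eq n k
    have h2 : ((n + 1 - k : ℕ) : ℝ) = n + 1 - k := by rw [Nat.cast_sub (by omega)]; push_cast; ring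
    rw [← h2]; exact_mod_cast this.symm
  rw [oddCoeff, evenCoeff, e2, prod_Ico_succ_top (by omega : k ≤ n),
    prod_Ico_succ_top (by omega : k ≤ n), prod_Ico_succ_top (by omega : k ≤ n)]
  beta_reduce at e1
  generalize ∏ i ∈ Ico k n, ((1 - 2 * (h : ℝ) + b) / 2 + (i + 1 : ℕ)) = x1 at *
  generalize ∏ i ∈ Ico k n, ((1 - 2 * (h : ℝ) + b) / 2 + (i : ℕ)) = y1 at *
  generalize ∏ i ∈ Ico k n, ((2 * h : ℝ) - (n + 1 : ℕ) - i) = x2 at *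
  generalize ∏ i ∈ Ico k n, -(((2 - 2 * (h : ℝ) + a) / 2 + i) * (1 - h + i)) = z at *
  generalize (1 - 2 * (h : ℝ) + b) / 2 = p at *
  generalize (2 - 2 * (h : ℝ) + a) / 2 = q at *
  generalize ((n + 1).choose k : ℝ) = c1 at *
  generalize (n.choose k : ℝ) = c0 at *
  have f1 : c0 = c1 * (n + 1 - k) / (n + 1) := by rw [eq_div_iff d7, ec]
  rw [← e1, f1]
  have d8 : (2 * h : ℝ) - (n + 1 : ℕ) - n ≠ 0 := by push_cast; linarith
  have e3 : (2 * h : ℝ) - (n + 1 : ℕ) - n = 2 * h - 2 * n - 1 := by push_cast; ring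
  rw [e3]
  generalize (2 * h : ℝ) - 2 * n - 1 = w at *
  field_simp

theorem evenCoeff_succ (hn : n < h) (hk : k ≤ n) :
    evenCoeff h a b (n + 1) k = -(evenCoeff h a b n k *
      ((n + 1) * ((1 - 2 * h + b) / 2 + n) * ((2 - 2 * h + a) / 2 + n) * (1 - h + n) *
          (2 * h - n - k) /
        ((n + 1 - k) * (2 * h - 2 * n) * (2 * h - 2 * n - 1)))) := by
  have hn' : (n : ℝ) + 1 ≤ h := by exact_mod_cast hn
  have hk' : (k : ℝ) ≤ n := by exact_mod_cast hk
  have e2 := prod_Ico_shift (fun i => (2 * h : ℝ) - n - i) hk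
  have e3 : ∏ i ∈ Ico k n, ((2 * h : ℝ) - n - (i + 1 : ℕ)) =
      ∏ i ∈ Ico k n, ((2 * h : ℝ) - (n + 1 : ℕ) - i) :=
    prod_congr rfl fun i _ => by push_cast; ring
  have d1 : ∏ i ∈ Ico k n, ((2 * h : ℝ) - n - i) ≠ 0 := prod_sub_ne_zero (by linarith)
  have d3 : (2 * h : ℝ) - 2 * n ≠ 0 := by linarith
  have d4 : (2 * h : ℝ) - n - k ≠ 0 := by linarith
  have d5 : (2 * h : ℝ) - 2 * n - 1 ≠ 0 := by linarith
  have d7 : (n : ℝ) + 1 - k ≠ 0 := by linarith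
  have ec : ((n + 1).choose k : ℝ) * (n + 1 - k) = n.choose k * (n + 1) := by
    have := Nat.choose_mul_succ_eq n k
    have h2 : ((n + 1 - k : ℕ) : ℝ) = n + 1 - k := by rw [Nat.cast_sub (by omega)]; push_cast; ring
    rw [← h2]; exact_mod_cast this.symm
  beta_reduce at e2
  rw [e3] at e2
  rw [evenCoeff, evenCoeff, prod_Ico_succ_top (by omega : k ≤ n),
    prod_Ico_succ_top (by omega : k ≤ n), prod_Ico_succ_top (by omega : k ≤ n)]
  have e4 : (2 * h : ℝ) - (n + 1 : ℕ) - n = 2 * h - 2 * n - 1 := by push_cast; ring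
  rw [e4]
  generalize ∏ i ∈ Ico k n, ((1 - 2 * (h : ℝ) + b) / 2 + (i : ℕ)) = y1 at *
  generalize ∏ i ∈ Ico k n, ((2 * h : ℝ) - (n + 1 : ℕ) - i) = x2 at *
  generalize ∏ i ∈ Ico k n, ((2 * h : ℝ) - n - i) = y2 at *
  generalize ∏ i ∈ Ico k n, -(((2 - 2 * (h : ℝ) + a) / 2 + i) * (1 - h + i)) = z at *
  generalize (1 - 2 * (h : ℝ) + b) / 2 = p at *
  generalize (2 - 2 * (h : ℝ) + a) / 2 = q at *
  generalize ((n + 1).choose k : ℝ) = c1 at *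
  generalize (n.choose k : ℝ) = c0 at *
  have f1 : c1 = c0 * (n + 1) / (n + 1 - k) := by rw [eq_div_iff d7, ec]
  have f2 : x2 = y2 * (2 * h - 2 * n) / (2 * h - n - k) := by
    rw [eq_div_iff d4, e2]; ring
  rw [f1, f2]
  clear f1 f2 e2 e3 e4 ec hn' hk'
  generalize (2 * h : ℝ) - 2 * n - 1 = w at *
  generalize (2 * h : ℝ) - 2 * n = w' at *
  generalize (2 * h : ℝ) - n - k = v at *
  generalize (n : ℝ) + 1 - k = v' at *
  field_simp

theorem oddCoeff_shift (hn : n < h) (hk : k + 1 ≤ n) :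
    oddCoeff h a b n k = -(evenCoeff h a b n (k + 1) *
      ((k + 1) * ((1 - 2 * h + b) / 2 + n) * ((2 - 2 * h + a) / 2 + k) * (1 - h + k) /
        ((n - k) * (2 * h - 2 * n)))) := by
  have hn' : (n : ℝ) + 1 ≤ h := by exact_mod_cast hn
  have hk' : (k : ℝ) + 1 ≤ n := by exact_mod_cast hk
  have s1 : ∀ f : ℕ → ℝ, ∏ i ∈ Ico k n, f (i + 1) = (∏ i ∈ Ico (k + 1) n, f i) * f n := by
    intro f
    rw [← prod_Ico_succ_top hk, ← prod_Ico_add' f k n 1]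
  have d1 : ∏ i ∈ Ico (k + 1) n, ((2 * h : ℝ) - n - i) ≠ 0 := prod_sub_ne_zero (by linarith)
  have d3 : (2 * h : ℝ) - 2 * n ≠ 0 := by linarith
  have d7 : (n : ℝ) - k ≠ 0 := by linarith
  have ec : (n.choose (k + 1) : ℝ) * (k + 1) = n.choose k * (n - k) := by
    have := Nat.choose_succ_right_eq n k
    have h2 : ((n - k : ℕ) : ℝ) = n - k := by rw [Nat.cast_sub (by omega)]
    rw [← h2]; exact_mod_cast this
  have e4 : (2 * h : ℝ) - n - n = 2 * h - 2 * n := by ring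
  rw [oddCoeff, evenCoeff, s1 (fun i => (1 - 2 * (h : ℝ) + b) / 2 + i),
    s1 (fun i => (2 * h : ℝ) - n - i), prod_eq_prod_Ico_succ_bot (by omega : k < n), e4]
  generalize ∏ i ∈ Ico (k + 1) n, ((1 - 2 * (h : ℝ) + b) / 2 + (i : ℕ)) = y1 at *
  generalize ∏ i ∈ Ico (k + 1) n, ((2 * h : ℝ) - n - i) = y2 at *
  generalize ∏ i ∈ Ico (k + 1) n, -(((2 - 2 * (h : ℝ) + a) / 2 + i) * (1 - h + i)) = z at *
  generalize (1 - 2 * (h : ℝ) + b) / 2 = p at *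
  generalize (2 - 2 * (h : ℝ) + a) / 2 = q at *
  generalize (n.choose (k + 1) : ℝ) = c1 at *
  generalize (n.choose k : ℝ) = c0 at *
  have f1 : c0 = c1 * (k + 1) / (n - k) := by rw [eq_div_iff d7, ec]
  rw [f1]
  field_simp

end Ratios

theorem oddCoeff_recurrence (ha : ∀ i < h, (2 - 2 * (h : ℝ) + a) / 2 + i ≠ 0)
    (hb : ∀ i < h, (1 - 2 * (h : ℝ) + b) / 2 + i ≠ 0) {n : ℕ} (hn : n + 1 < h) (k : ℕ) :
    oddCoeff h a b (n + 1) k = evenCoeff h a b (n + 1) k -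
      (-(1 / 16) * ((2 * n + 2 - 2 * h + a) * (2 * n + 2) * (2 * n + 1 - 2 * h - b) /
        (2 * n + 1 - 2 * h))) * oddCoeff h a b n k := by
  rcases lt_trichotomy k (n + 1) with hk | rfl | hk
  · have hk : k ≤ n := by omega
    have hn' : (n : ℝ) + 2 ≤ h := by exact_mod_cast hn
    have hk' : (k : ℝ) ≤ n := by exact_mod_cast hk
    rw [oddCoeff_eq hb hn (by omega : k ≤ n + 1), oddCoeff_pred hb ha hn hk]
    have d1 := hb k (by omega)
    have d2 := ha n (by omega)
    have d3 : (2 * h : ℝ) - 2 * n - 1 ≠ 0 := by linarith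
    have d4 : (1 : ℝ) - h + n ≠ 0 := by linarith
    have d7 : (n : ℝ) + 1 ≠ 0 := by positivity
    generalize evenCoeff h a b (n + 1) k = γ
    have e1 : (2 * n + 1 - 2 * h : ℝ) = -((2 * h : ℝ) - 2 * n - 1) := by ring
    have e2 : (2 * h : ℝ) - 2 * (n + 1 : ℕ) = -2 * ((1 : ℝ) - h + n) := by push_cast; ring
    have e3 : (2 * n + 2 - 2 * h + a : ℝ) = 2 * ((2 - 2 * (h : ℝ) + a) / 2 + n) := by ring
    obtain ⟨p, hp⟩ : ∃ p, p = (1 - 2 * (h : ℝ) + b) / 2 := ⟨_, rfl⟩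
    have e4 : b = 2 * p - 1 + 2 * h := by rw [hp]; ring
    rw [e1, e2, e3]
    rw [← hp] at d1 ⊢
    rw [e4]
    push_cast
    clear hp e1 e2 e3 e4 ha hb
    generalize hw : (2 * h : ℝ) - 2 * n - 1 = w at *
    generalize hv : (1 : ℝ) - h + n = v at *
    generalize hq : (2 - 2 * (h : ℝ) + a) / 2 + n = q at *
    field_simp
    rw [← hw, ← hv]
    ring
  · rw [oddCoeff_self, evenCoeff_self, oddCoeff_of_lt (by omega)]; ring
  · rw [oddCoeff_of_lt hk, evenCoeff_of_lt hk, oddCoeff_of_lt (by omega)]; ring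

/-- The first two terms on the right come from multiplying the `k`-th basis element by `X² - r²`, `r
= (b - 2h - 1 - a)/4`: it yields the next basis element plus a multiple of itself. -/
theorem evenCoeff_recurrence (hb : ∀ i < h, (1 - 2 * (h : ℝ) + b) / 2 + i ≠ 0) {n : ℕ} (hn : n < h)
    (k : ℕ) :
    evenCoeff h a b (n + 1) k = (if k = 0 then 0 else oddCoeff h a b n (k - 1)) +
      (k + 1 + a / 2) * (k + (b - 2 * h + 1) / 2) * oddCoeff h a b n k -
      (-(1 / 16) * ((2 * n - 2 * h - a) * (2 * n - 4 * h) * (2 * n + 1 - 2 * h + b) /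
        (2 * n + 1 - 2 * h))) * evenCoeff h a b n k := by
  rcases lt_trichotomy k (n + 1) with hk | rfl | hk
  · have hk : k ≤ n := by omega
    have hn' : (n : ℝ) + 1 ≤ h := by exact_mod_cast hn
    have hk' : (k : ℝ) ≤ n := by exact_mod_cast hk
    have hs : (if k = 0 then 0 else oddCoeff h a b n (k - 1)) = -(evenCoeff h a b n k *
      (k * ((1 - 2 * h + b) / 2 + n) * ((2 - 2 * h + a) / 2 + k - 1) * (k - h) /
        ((n + 1 - k) * (2 * h - 2 * n)))) := by
      cases k with
      | zero => simp
      | succ k =>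
        rw [if_neg (by omega), Nat.add_sub_cancel, oddCoeff_shift hn hk]
        push_cast
        rw [show (n : ℝ) + 1 - (k + 1) = n - k by ring,
          show (2 - 2 * (h : ℝ) + a) / 2 + (k + 1) - 1 = (2 - 2 * (h : ℝ) + a) / 2 + k by ring,
          show (k : ℝ) + 1 - h = 1 - h + k by ring]
    rw [hs, oddCoeff_eq hb hn hk, evenCoeff_succ hn hk]
    have d1 := hb k (by omega)
    have d3 : (2 * h : ℝ) - 2 * n - 1 ≠ 0 := by linarith
    have d4 : (2 * h : ℝ) - 2 * n ≠ 0 := by linarith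
    have d7 : (n : ℝ) + 1 - k ≠ 0 := by linarith
    generalize evenCoeff h a b n k = γ
    have e1 : (2 * n + 1 - 2 * h : ℝ) = -((2 * h : ℝ) - 2 * n - 1) := by ring
    have e2 : (k + (b - 2 * h + 1) / 2 : ℝ) = (1 - 2 * (h : ℝ) + b) / 2 + k := by ring
    rw [e1, e2]
    obtain ⟨p, hp⟩ : ∃ p, p = (1 - 2 * (h : ℝ) + b) / 2 := ⟨_, rfl⟩
    have e4 : b = 2 * p - 1 + 2 * h := by rw [hp]; ring
    rw [← hp] at d1 ⊢
    rw [e4]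
    clear hp e1 e2 e4 hb hs
    generalize hw : (2 * h : ℝ) - 2 * n - 1 = w at *
    generalize hv : (2 * h : ℝ) - 2 * n = v at *
    generalize hu : (n : ℝ) + 1 - k = t at *
    field_simp
    -- After clearing denominators, everything is written in the independent variables `v`, `t`,
    -- `n`, `a`, `p`.
    have hh : (h : ℝ) = v / 2 + n := by linarith
    have hkk : (k : ℝ) = n + 1 - t := by linarith
    have hww : w = v - 1 := by linarith
    rw [hh, hkk, hww]
    ring
  · rw [oddCoeff_of_lt (Nat.lt_succ_self n), evenCoeff_of_lt (Nat.lt_succ_self n), evenCoeff_self,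
      if_neg (by omega), Nat.add_sub_cancel, oddCoeff_self]; ring
  · rw [oddCoeff_of_lt (by omega : n < k), evenCoeff_of_lt hk, evenCoeff_of_lt (by omega : n < k),
      if_neg (by omega), oddCoeff_of_lt (by omega)]; ring

/-- The basis in which the complementary Bannai-Ito polynomials are expanded. -/
noncomputable def evenBasis (ρ : ℝ) (k : ℕ) : ℝ[X] :=
  ∏ i ∈ range k, (X ^ 2 - Polynomial.C ((ρ + (i + 1)) ^ 2))

theorem evenBasis_succ (ρ : ℝ) (k : ℕ) :
    evenBasis ρ (k + 1) = (X ^ 2 - Polynomial.C ((ρ + (k + 1)) ^ 2)) * evenBasis ρ k := by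
  rw [evenBasis, prod_range_succ, mul_comm, ← evenBasis]

/-! ### Expansion of `P0` up to the middle degree -/

theorem coeffC0_eq (j : ℕ) (a b α : ℝ) : coeffC0 j a b α = coeffA1 j a b α := rfl

theorem coeffA0_eq (j : ℕ) (a b α : ℝ) (n : ℕ) : coeffA0 j a b α n = coeffC1 j a b α (n + 1) := by
  have e : ((n + 1 : ℕ) : ℝ) - j - 1 = n - j := by push_cast; ring
  rw [coeffA0, coeffC1, e]
  simp only [Nat.add_right_cancel_iff]
  by_cases hn : Even n
  · rw [if_pos hn, if_neg (show ¬ Even (n + 1) by simpa [Nat.even_add_one] using hn)]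
  · rw [if_neg hn, if_pos (show Even (n + 1) by simpa [Nat.even_add_one] using hn)]; push_cast; rfl

theorem P0_one (hh : 0 < h) (a b α : ℝ) :
    P0 (2 * h) a b α 1 = X - Polynomial.C ((b - 2 * h - 1 - a) / 4) := by
  have h0 : 0 ≠ 2 * h := by omega
  rw [P0, recPoly_one, rho1, coeffA0, coeffC0, if_pos Even.zero, if_pos Even.zero, if_neg h0,
    if_neg h0]
  congr 2; push_cast; ring

/-- Below the middle the diagonal entries of the recurrence alternate between `r` and `-r`, `r = (b
- 2h - 1 - a)/4`. Hence even degrees give even polynomials, and odd degrees give `X - r` times even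
ones. -/
theorem P0_odd_step {n : ℕ} (hn : n + 1 < h) (a b α : ℝ) :
    P0 (2 * h) a b α (2 * (n + 1) + 1) =
      (X - Polynomial.C ((b - 2 * h - 1 - a) / 4)) * P0 (2 * h) a b α (2 * (n + 1)) -
      Polynomial.C (-(1 / 16) * ((2 * n + 2 - 2 * h + a) * (2 * n + 2) * (2 * n + 1 - 2 * h - b) /
        (2 * n + 1 - 2 * h))) * P0 (2 * h) a b α (2 * n + 1) := by
  have h1 : ¬ Even (2 * n + 1) := by simp [parity_simps]
  have h2 : Even (2 * n + 1 + 1) := by simp [parity_simps]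
  have h3 : 2 * n + 1 + 1 ≠ 2 * h := by omega
  have hn' : (n : ℝ) + 2 ≤ h := by exact_mod_cast hn
  have d : (2 * n + 1 - 2 * h : ℝ) ≠ 0 := by linarith
  rw [P0, P0, P0, show 2 * (n + 1) + 1 = 2 * n + 1 + 2 by ring, recPoly_add_two,
    show 2 * (n + 1) = 2 * n + 1 + 1 by ring]
  congr 2
  · congr 2
    rw [rho1, coeffA0, coeffC0, if_pos h2, if_pos h2, if_neg h3, if_neg h3]; push_cast; ring
  · congr 1
    rw [coeffA0, coeffC0, if_neg h1, if_pos h2, if_neg h3]; push_cast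
    field_simp
    ring

theorem P0_even_step {n : ℕ} (hn : n < h) (a b α : ℝ) :
    P0 (2 * h) a b α (2 * (n + 1)) =
      (X + Polynomial.C ((b - 2 * h - 1 - a) / 4)) * P0 (2 * h) a b α (2 * n + 1) -
      Polynomial.C (-(1 / 16) * ((2 * n - 2 * h - a) * (2 * n - 4 * h) * (2 * n + 1 - 2 * h + b) /
        (2 * n + 1 - 2 * h))) * P0 (2 * h) a b α (2 * n) := by
  have h1 : ¬ Even (2 * n + 1) := by simp [parity_simps]
  have h2 : Even (2 * n) := by simp
  have h3 : 2 * n ≠ 2 * h := by omega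
  have hn' : (n : ℝ) + 1 ≤ h := by exact_mod_cast hn
  have d : (2 * n + 1 - 2 * h : ℝ) ≠ 0 := by linarith
  rw [P0, P0, P0, show 2 * (n + 1) = 2 * n + 2 by ring, recPoly_add_two]
  congr 2
  · rw [← sub_neg_eq_add, ← map_neg]
    congr 2
    rw [rho1, coeffA0, coeffC0, if_neg h1, if_neg h1]; push_cast
    field_simp
    ring
  · congr 1
    rw [coeffA0, coeffC0, if_neg h1, if_pos h2, if_neg h3]; push_cast
    field_simp
    ring

theorem P0_expansion (ha : ∀ i < h, (2 - 2 * (h : ℝ) + a) / 2 + i ≠ 0)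
    (hb : ∀ i < h, (1 - 2 * (h : ℝ) + b) / 2 + i ≠ 0) (α : ℝ) (n : ℕ) (hn : n ≤ h) :
    P0 (2 * h) a b α (2 * n) = ∑ k ∈ range (n + 1),
        Polynomial.C (evenCoeff h a b n k) * evenBasis ((b - 2 * h - 1 + a) / 4) k ∧
      (n < h → P0 (2 * h) a b α (2 * n + 1) = (X - Polynomial.C ((b - 2 * h - 1 - a) / 4)) *
        ∑ k ∈ range (n + 1),
          Polynomial.C (oddCoeff h a b n k) * evenBasis ((b - 2 * h - 1 + a) / 4) k) := by
  induction n with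
  | zero =>
    simp only [mul_zero, zero_add, sum_range_one, evenCoeff_self, oddCoeff_self, map_one, one_mul]
    refine ⟨by simp [P0, recPoly_zero, evenBasis], fun hh => ?_⟩
    simp [P0_one hh, evenBasis]
  | succ n ih =>
    obtain ⟨ih₀, ih₁⟩ := ih (by omega)
    have ih₁ := ih₁ (by omega)
    have he : P0 (2 * h) a b α (2 * (n + 1)) = ∑ k ∈ range (n + 1 + 1),
        Polynomial.C (evenCoeff h a b (n + 1) k) * evenBasis ((b - 2 * h - 1 + a) / 4) k := by
      have s1 : ∑ k ∈ range (n + 1), Polynomial.C (oddCoeff h a b n k) *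
            evenBasis ((b - 2 * h - 1 + a) / 4) (k + 1) =
          ∑ k ∈ range (n + 1 + 1), Polynomial.C (if k = 0 then 0 else oddCoeff h a b n (k - 1)) *
            evenBasis ((b - 2 * h - 1 + a) / 4) k := by
        rw [eq_comm, sum_range_succ']; simp
      have s2 : ∑ k ∈ range (n + 1), Polynomial.C ((k + 1 + a / 2) * (k + (b - 2 * h + 1) / 2) *
            oddCoeff h a b n k) * evenBasis ((b - 2 * h - 1 + a) / 4) k =
          ∑ k ∈ range (n + 1 + 1), Polynomial.C ((k + 1 + a / 2) * (k + (b - 2 * h + 1) / 2) *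
            oddCoeff h a b n k) * evenBasis ((b - 2 * h - 1 + a) / 4) k := by
        rw [sum_range_succ _ (n + 1), oddCoeff_of_lt (Nat.lt_succ_self n)]; simp
      have s3 : ∑ k ∈ range (n + 1), Polynomial.C (evenCoeff h a b n k) *
            evenBasis ((b - 2 * h - 1 + a) / 4) k =
          ∑ k ∈ range (n + 1 + 1), Polynomial.C (evenCoeff h a b n k) *
            evenBasis ((b - 2 * h - 1 + a) / 4) k := by
        rw [sum_range_succ _ (n + 1), evenCoeff_of_lt (Nat.lt_succ_self n)]; simp
      have s4 : (X + Polynomial.C ((b - 2 * h - 1 - a) / 4)) *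
          ((X - Polynomial.C ((b - 2 * h - 1 - a) / 4)) * ∑ k ∈ range (n + 1),
            Polynomial.C (oddCoeff h a b n k) * evenBasis ((b - 2 * h - 1 + a) / 4) k) =
          ∑ k ∈ range (n + 1), Polynomial.C (oddCoeff h a b n k) *
            evenBasis ((b - 2 * h - 1 + a) / 4) (k + 1) +
          ∑ k ∈ range (n + 1), Polynomial.C ((k + 1 + a / 2) * (k + (b - 2 * h + 1) / 2) *
            oddCoeff h a b n k) * evenBasis ((b - 2 * h - 1 + a) / 4) k := by
        rw [← mul_assoc, mul_sum, ← sum_add_distrib]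
        refine sum_congr rfl fun k _ => ?_
        -- This splits `X² - r²` into the next factor of the basis and a constant.
        have e : ((k : ℝ) + 1 + a / 2) * (k + (b - 2 * h + 1) / 2) =
          ((b - 2 * h - 1 + a) / 4 + (k + 1)) ^ 2 - ((b - 2 * h - 1 - a) / 4) ^ 2 := by ring
        rw [evenBasis_succ, e]
        generalize (b - 2 * h - 1 - a) / 4 = r
        simp only [map_mul, map_sub, map_pow]
        ring
      rw [P0_even_step (by omega), ih₀, ih₁, s4, s1, s2, s3, mul_sum, ← sum_add_distrib,
        ← sum_sub_distrib]
      refine sum_congr rfl fun k _ => ?_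
      rw [evenCoeff_recurrence hb (by omega) k, map_sub, map_add]
      simp only [map_mul]
      ring
    refine ⟨he, fun hlt => ?_⟩
    have s3 : ∑ k ∈ range (n + 1), Polynomial.C (oddCoeff h a b n k) *
          evenBasis ((b - 2 * h - 1 + a) / 4) k =
        ∑ k ∈ range (n + 1 + 1), Polynomial.C (oddCoeff h a b n k) *
          evenBasis ((b - 2 * h - 1 + a) / 4) k := by
      rw [sum_range_succ _ (n + 1), oddCoeff_of_lt (Nat.lt_succ_self n)]; simp
    rw [P0_odd_step hlt, he, ih₁, s3, mul_left_comm, ← mul_sub, mul_sum, ← sum_sub_distrib]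
    congr 1
    refine sum_congr rfl fun k _ => ?_
    rw [oddCoeff_recurrence ha hb hlt k, map_sub]
    simp only [map_mul]
    ring

theorem P0_middle (ha : ∀ i < h, (2 - 2 * (h : ℝ) + a) / 2 + i ≠ 0)
    (hb : ∀ i < h, (1 - 2 * (h : ℝ) + b) / 2 + i ≠ 0) (α : ℝ) :
    P0 (2 * h) a b α (2 * h) = evenBasis ((b - 2 * h - 1 + a) / 4) h := by
  rw [(P0_expansion ha hb α h le_rfl).1, sum_range_succ, evenCoeff_self, sum_eq_zero, map_one,
    one_mul, zero_add]
  intro k hk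
  rw [evenCoeff_top (mem_range.1 hk), map_zero, zero_mul]

/-! ### The two halves of the lattice -/

theorem poch_eq_prod (x : ℝ) (k : ℕ) : poch x k = ∏ i ∈ range k, (x + i) := by
  induction k with
  | zero => simp [poch]
  | succ k ih => rw [prod_range_succ, ← ih, poch, ascPochhammer_succ_eval, ← poch]

theorem poch_succ (x : ℝ) (k : ℕ) : poch x (k + 1) = poch x k * (x + k) := by
  rw [poch_eq_prod, prod_range_succ, ← poch_eq_prod]

theorem poch_zero (x : ℝ) : poch x 0 = 1 := by simp [poch]

theorem poch_add (x : ℝ) (k m : ℕ) : poch x (k + m) = poch x k * poch (x + k) m := by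
  rw [poch_eq_prod, prod_range_add, poch_eq_prod, poch_eq_prod]
  simp [add_assoc]

theorem prod_neg_add (x : ℝ) (k : ℕ) :
    ∏ i ∈ range k, -(x + (i : ℝ)) = (-1) ^ k * poch x k := by
  rw [prod_neg, card_range, poch_eq_prod]

theorem poch_reflect (x : ℝ) (k : ℕ) : poch x k = (-1) ^ k * poch (1 - x - k) k := by
  rw [← prod_neg_add, ← prod_range_reflect, poch_eq_prod]
  refine prod_congr rfl fun i hi => ?_
  have := mem_range.1 hi
  rw [Nat.cast_sub (by omega), Nat.cast_sub (by omega)]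
  push_cast; ring

theorem poch_ne_zero {x : ℝ} {k : ℕ} (hx : ∀ i < k, x + i ≠ 0) : poch x k ≠ 0 := by
  rw [poch_eq_prod, prod_ne_zero_iff]
  exact fun i hi => hx i (mem_range.1 hi)

section Recurrence

variable {r r' : ℝ} {A C A' C' : ℕ → ℝ}

/-- Two Jacobi matrices that differ only in the last diagonal entry: expansion in that entry leaves
a multiple of the previous polynomial. -/
theorem recPoly_succ_of_congr {N : ℕ}
    (hd : ∀ i < N, r - A i - C i = r' - A' i - C' i)
    (hu : ∀ i < N, A i * C (i + 1) = A' i * C' (i + 1)) :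
    recPoly r A C (N + 1) = recPoly r' A' C' (N + 1) +
      Polynomial.C ((r' - A' N - C' N) - (r - A N - C N)) * recPoly r A C N := by
  have hc := recPoly_congr (N := N) hd fun i hi => hu i (by omega)
  cases N with
  | zero => rw [recPoly_one, recPoly_one, recPoly_zero]; simp only [map_sub]; ring
  | succ N =>
    rw [recPoly_add_two, recPoly_add_two, hc N (by omega), hc (N + 1) le_rfl, hu N (by omega)]
    simp only [map_sub]
    ring

end Recurrence

/-- The monic polynomial vanishing on the points `grid (4 s + 1)` and `grid (4 s + 3)`. -/
noncomputable def nodePoly (h : ℕ) (a b : ℝ) : ℝ[X] :=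
  (∏ s ∈ range (h + 1), (X - Polynomial.C ((b - 2 * h - 1 + a) / 4 + (h - s)))) *
    ∏ s ∈ range h, (X - Polynomial.C (-((b - 2 * h - 1 + a) / 4 + (h - s))))

theorem nodePoly_eq (h : ℕ) (a b : ℝ) :
    nodePoly h a b = (X - Polynomial.C ((b - 2 * h - 1 + a) / 4)) *
      evenBasis ((b - 2 * h - 1 + a) / 4) h := by
  -- The factor `s = h` of the first product is the unpaired `X - ρ₁`; the others pair with the
  -- second product as differences of squares.
  rw [nodePoly, prod_range_succ, sub_self, add_zero, evenBasis,
    ← prod_range_reflect (fun i : ℕ => (X : ℝ[X]) ^ 2 -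
      Polynomial.C (((b - 2 * h - 1 + a) / 4 + ((i : ℝ) + 1)) ^ 2)), mul_right_comm, mul_comm, ← prod_mul_distrib]
  congr 1
  refine prod_congr rfl fun s hs => ?_
  have := mem_range.1 hs
  rw [Nat.cast_sub (by omega), Nat.cast_sub (by omega), map_neg, map_pow]
  have e : (b - 2 * h - 1 + a) / 4 + ((h : ℝ) - (1 : ℕ) - s + 1) =
    (b - 2 * h - 1 + a) / 4 + (h - s) := by push_cast; ring
  rw [e]; ring

/-! ### Symmetries of the coefficients of `P1` and the factorization of its top polynomial -/

theorem coeffA1_odd (j : ℕ) (a b α : ℝ) {n : ℕ} (hn : ¬ Even n) :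
    coeffA1 j a b α n = (1 / 4) * ((((n : ℝ) - 2 * j - 1) * ((n : ℝ) - j + b)) / ((n : ℝ) - j)) := by
  rw [coeffA1, if_neg hn]

theorem coeffA1_even (j : ℕ) (a b α : ℝ) {n : ℕ} (hn : Even n) (hj : n ≠ j) :
    coeffA1 j a b α n = (1 / 4) * ((n : ℝ) - j + a) := by
  rw [coeffA1, if_pos hn, if_neg hj]

theorem coeffA1_self {j : ℕ} (a b α : ℝ) (hj : Even j) :
    coeffA1 j a b α j = (1 / 2) * α * a := by
  rw [coeffA1, if_pos hj, if_pos rfl]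

theorem coeffC1_even (j : ℕ) (a b α : ℝ) {n : ℕ} (hn : Even n) :
    coeffC1 j a b α n = -(1 / 4) * (((n : ℝ) * ((n : ℝ) - j - 1 - b)) / ((n : ℝ) - j - 1)) := by
  rw [coeffC1, if_pos hn]

theorem coeffC1_odd (j : ℕ) (a b α : ℝ) {n : ℕ} (hn : ¬ Even n) (hj : n ≠ j + 1) :
    coeffC1 j a b α n = -(1 / 4) * ((n : ℝ) - j - 1 - a) := by
  rw [coeffC1, if_neg hn, if_neg hj]

theorem coeffC1_self {j : ℕ} (a b α : ℝ) (hj : Even j) :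
    coeffC1 j a b α (j + 1) = (1 / 2) * (1 - α) * a := by
  rw [coeffC1, if_neg (by simpa [Nat.even_add_one] using hj), if_pos rfl]

theorem coeffC1_zero (j : ℕ) (a b α : ℝ) : coeffC1 j a b α 0 = 0 := by
  rw [coeffC1_even _ _ _ _ Even.zero]; simp

/-- As `n + m` is odd, the reflection swaps parities and matches the exceptional entry `A` at `j`
with the exceptional `C` at `j + 1`, whose values differ by `α ↔ 1 - α`. -/
theorem coeffA1_mirror {j : ℕ} (hj : Even j) (a b α : ℝ) (n m : ℕ) (hnm : n + m = 2 * j + 1) :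
    coeffA1 j a b (1 - α) m = coeffC1 j a b α n := by
  have hc : (n : ℝ) + m = 2 * j + 1 := by exact_mod_cast hnm
  have hm : (m : ℝ) = 2 * j + 1 - n := by linarith
  by_cases hn : Even n
  · have hm' : ¬ Even m := by
      intro hm'
      have h1 := hn.add hm'
      rw [hnm] at h1
      simp [parity_simps] at h1
    rw [coeffA1_odd _ _ _ _ hm', coeffC1_even _ _ _ _ hn, hm,
      show (2 * (j : ℝ) + 1 - n - j) = -(n - j - 1) by ring, div_neg,
      show (2 * (j : ℝ) + 1 - n - 2 * j - 1) * (-(n - j - 1) + b) = n * (n - j - 1 - b) by ring]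
    ring
  · have hm' : Even m := by
      by_contra hm'
      have h1 := (Nat.not_even_iff_odd.1 hn).add_odd (Nat.not_even_iff_odd.1 hm')
      rw [hnm] at h1
      simp [parity_simps] at h1
    by_cases hj' : m = j
    · obtain rfl : n = j + 1 := by omega
      rw [hj', coeffA1_self _ _ _ hj, coeffC1_self _ _ _ hj]
    · rw [coeffA1_even _ _ _ _ hm' hj', coeffC1_odd _ _ _ _ hn (by omega), hm]
      ring

theorem coeffC1_mirror {j : ℕ} (hj : Even j) (a b α : ℝ) (n m : ℕ) (hnm : n + m = 2 * j + 1) :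
    coeffC1 j a b (1 - α) m = coeffA1 j a b α n := by
  have := coeffA1_mirror hj a b (1 - α) m n (by omega)
  rwa [sub_sub_cancel, eq_comm] at this

/-- Dependence on the parameters of the coefficients in the first half of the recurrence. -/
theorem coeff1_congr (j : ℕ) (a b α α' : ℝ) {i : ℕ} (hi : i < j) :
    (rho1 j a b - coeffA1 j a b α i - coeffC1 j a b α i =
      rho1 j a b - coeffA1 j a b α' i - coeffC1 j a b α' i) ∧
    (coeffA1 j a b α i * coeffC1 j a b α (i + 1) =
      coeffA1 j a b α' i * coeffC1 j a b α' (i + 1)) := by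
  rw [coeffA1, coeffA1, coeffC1, coeffC1, coeffC1, coeffC1]
  have hi' : i ≠ j + 1 := by omega
  simp [hi.ne, hi']

/-- In the first half of the recurrence the coefficients are even in `a`. -/
theorem coeff1_neg (j : ℕ) (a b α : ℝ) {i : ℕ} (hi : i < j) :
    (rho1 j a b - coeffA1 j a b α i - coeffC1 j a b α i =
      rho1 j (-a) b - coeffA1 j (-a) b α i - coeffC1 j (-a) b α i) ∧
    (coeffA1 j a b α i * coeffC1 j a b α (i + 1) =
      coeffA1 j (-a) b α i * coeffC1 j (-a) b α (i + 1)) := by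
  by_cases hn : Even i
  · have hn' : ¬ Even (i + 1) := by simpa [Nat.even_add_one] using hn
    simp only [coeffA1_even _ _ _ _ hn hi.ne, coeffC1_even _ _ _ _ hn,
      coeffC1_odd _ _ _ _ hn' (by omega : i + 1 ≠ j + 1), rho1]
    push_cast
    constructor <;> ring
  · have hn' : Even (i + 1) := by simpa [Nat.even_add_one] using hn
    simp only [coeffA1_odd _ _ _ _ hn, coeffC1_odd _ _ _ _ hn (by omega : i ≠ j + 1),
      coeffC1_even _ _ _ _ hn', rho1]
    exact ⟨by ring, trivial⟩

theorem P1_congr (j : ℕ) (a b α α' : ℝ) : P1 j a b α j = P1 j a b α' j :=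
  recPoly_congr (fun _ hi => (coeff1_congr j a b α α' hi).1)
    (fun _ hi => (coeff1_congr j a b α α' (by omega)).2) j le_rfl

theorem P1_middle {j : ℕ} (hj : Even j) (a b α α' : ℝ) :
    P1 j a b α (j + 1) = P1 j a b α' (j + 1) +
      Polynomial.C ((α - α') * a / 2) * P1 j a b α j := by
  rw [P1, recPoly_succ_of_congr (fun _ hi => (coeff1_congr j a b α α' hi).1)
    (fun _ hi => (coeff1_congr j a b α α' hi).2), ← P1, ← P1, coeffA1_self _ _ _ hj,
    coeffA1_self _ _ _ hj, show coeffC1 j a b α' j = coeffC1 j a b α j by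
      rw [coeffC1_even _ _ _ _ hj, coeffC1_even _ _ _ _ hj]]
  congr 3; ring

/-- At `α = 0` the entry `A` at `j` vanishes and `C` at `j` is free of `a`, so only `ρ₁` sees the
sign of `a` in the last diagonal entry. -/
theorem P1_middle_neg {j : ℕ} (hj : Even j) (a b : ℝ) :
    P1 j (-a) b 0 (j + 1) = P1 j a b 0 (j + 1) + Polynomial.C (a / 2) * P1 j a b 0 j := by
  have := recPoly_succ_of_congr (fun _ hi => (coeff1_neg j a b 0 hi).1)
    (fun _ hi => (coeff1_neg j a b 0 hi).2)
  rw [P1, P1, P1, this, add_assoc, ← add_mul, ← map_add, coeffA1_self _ _ _ hj,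
    coeffA1_self _ _ _ hj, coeffC1_even _ _ _ _ hj, coeffC1_even _ _ _ _ hj, rho1, rho1,
    left_eq_add]
  rw [mul_eq_zero]
  left
  rw [map_eq_zero]
  ring

theorem X_sub_C_mul_P0 (j : ℕ) (a b α : ℝ) (n : ℕ) :
    (X - Polynomial.C (rho1 j a b)) * P0 j a b α n =
      P1 j a b α (n + 1) - Polynomial.C (coeffA1 j a b α n) * P1 j a b α n := by
  have := X_sub_C_mul_recPoly (r := rho1 j a b) (A := coeffA1 j a b α) (C := coeffC1 j a b α)
    (coeffC1_zero j a b α) n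
  rw [P0, coeffC0_eq, funext (coeffA0_eq j a b α), this, ← P1, ← P1]

/-- At `α = 0` the kernel identity loses its second term, because `A` at `j` is `0`. -/
theorem P1_zero_middle (ha : ∀ i < h, (2 - 2 * (h : ℝ) + a) / 2 + i ≠ 0)
    (hb : ∀ i < h, (1 - 2 * (h : ℝ) + b) / 2 + i ≠ 0) :
    P1 (2 * h) a b 0 (2 * h + 1) = nodePoly h a b := by
  have := X_sub_C_mul_P0 (2 * h) a b 0 (2 * h)
  rw [coeffA1_self _ _ _ (even_two_mul h), P0_middle ha hb, rho1] at this
  rw [nodePoly_eq]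
  push_cast at this
  rw [this]; simp

/-- The coupling `α(1 - α)(a/2)²` in the middle cancels exactly the `α`-dependence of the product of
the two halves. -/
theorem P1_top_mul {j : ℕ} (hj : Even j) (a b α : ℝ) :
    P1 j a b α (2 * j + 2) = P1 j a b 0 (j + 1) * P1 j (-a) b 0 (j + 1) := by
  have : P1 j a b α (2 * j + 1 + 1) = P1 j a b α (j + 1) * P1 j a b (1 - α) (j + 1) -
      Polynomial.C (coeffA1 j a b α j * coeffC1 j a b α (j + 1)) *
        (P1 j a b α j * P1 j a b (1 - α) j) :=
    recPoly_mirror (coeffA1_mirror hj a b α) (coeffC1_mirror hj a b α) j j (by omega)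
  rw [show 2 * j + 2 = 2 * j + 1 + 1 by ring, this, P1_middle_neg hj, P1_middle hj a b α 0,
    P1_middle hj a b (1 - α) 0, P1_congr j a b α 0, P1_congr j a b (1 - α) 0,
    coeffA1_self _ _ _ hj, coeffC1_self _ _ _ hj]
  have e1 : (α - 0) * a / 2 = α * (a / 2) := by ring
  have e2 : (1 - α - 0) * a / 2 = (1 - α) * (a / 2) := by ring
  have e3 : 1 / 2 * α * a * (1 / 2 * (1 - α) * a) = α * (1 - α) * (a / 2) ^ 2 := by ring
  rw [e1, e2, e3]
  simp only [map_mul, map_sub, map_one, map_pow]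
  ring

/-! ### The points of the lattice -/

theorem grid_four_mul_add_one (h s : ℕ) (a b : ℝ) :
    grid (2 * h) a b (4 * s + 1) = (b - 2 * h - 1 + a) / 4 + (h - s) := by
  have h1 : ¬ Even (4 * s + 1) := by simp [parity_simps]
  have h2 : (4 * s + 1) / 2 = 2 * s := by omega
  rw [grid, if_neg h1, h2, pow_mul]
  push_cast; ring

theorem grid_four_mul (h s : ℕ) (a b : ℝ) :
    grid (2 * h) a b (4 * s) = (b - 2 * h - 1 + -a) / 4 + (h - s) := by
  have h1 : Even (4 * s) := by simp [parity_simps]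
  have h2 : (4 * s) / 2 = 2 * s := by omega
  rw [grid, if_pos h1, h2, pow_mul]
  push_cast; ring

theorem grid_four_mul_add_three (h s : ℕ) (a b : ℝ) :
    grid (2 * h) a b (4 * s + 3) = -((b - 2 * h - 1 + a) / 4 + (h - s)) := by
  have h1 : ¬ Even (4 * s + 3) := by simp [parity_simps]
  have h2 : (4 * s + 3) / 2 = 2 * s + 1 := by omega
  rw [grid, if_neg h1, h2, pow_succ, pow_mul]
  push_cast; ring

theorem grid_four_mul_add_two (h s : ℕ) (a b : ℝ) :
    grid (2 * h) a b (4 * s + 2) = -((b - 2 * h - 1 + -a) / 4 + (h - s)) := by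
  have h1 : Even (4 * s + 2) := by simp [parity_simps]
  have h2 : (4 * s + 2) / 2 = 2 * s + 1 := by omega
  rw [grid, if_pos h1, h2, pow_succ, pow_mul]
  push_cast; ring

theorem prod_range_four {M : Type*} [CommMonoid M] (f : ℕ → M) (h : ℕ) :
    ∏ k ∈ range (4 * h + 2), f k =
      ((∏ s ∈ range (h + 1), f (4 * s + 1)) * ∏ s ∈ range h, f (4 * s + 3)) *
      ((∏ s ∈ range (h + 1), f (4 * s)) * ∏ s ∈ range h, f (4 * s + 2)) := by
  induction h with
  | zero => simp [prod_range_succ, mul_comm]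
  | succ h ih =>
    rw [show 4 * (h + 1) + 2 = 4 * h + 2 + 1 + 1 + 1 + 1 by ring, prod_range_succ, prod_range_succ,
      prod_range_succ, prod_range_succ, ih]
    simp only [prod_range_succ, mul_add, add_assoc, Nat.reduceAdd, mul_one]
    ac_rfl

theorem nodePoly_mul_nodePoly_neg (h : ℕ) (a b : ℝ) :
    nodePoly h a b * nodePoly h (-a) b =
      ∏ s ∈ range (4 * h + 2), (X - Polynomial.C (grid (2 * h) a b s)) := by
  rw [prod_range_four]
  simp only [grid_four_mul, grid_four_mul_add_one, grid_four_mul_add_two, grid_four_mul_add_three]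
  rw [nodePoly, nodePoly]

/-! ### Values of the derivative at the points of the lattice -/

theorem eval_derivative_X_sub_C_mul (y : ℝ) (Q : ℝ[X]) :
    (derivative ((X - Polynomial.C y) * Q)).eval y = Q.eval y := by simp

theorem prod_range_split {M : Type*} [CommMonoid M] (f : ℕ → M) (s d : ℕ) :
    ∏ i ∈ range (s + d + 1), f i =
      f s * ((∏ i ∈ range s, f i) * ∏ i ∈ range d, f (s + 1 + i)) := by
  rw [show s + d + 1 = s + 1 + d by ring, prod_range_add, prod_range_succ]
  ac_rfl

theorem eval_derivative_first {s : ℕ} (hs : s ≤ h) :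
    (derivative (nodePoly h a b * nodePoly h (-a) b)).eval
        ((b - 2 * h - 1 + a) / 4 + (h - s)) =
      poch (-s) s * poch 1 (h - s) * poch (-s + a / 2) (h + 1) *
        poch (s + (1 - a - b - 2 * h) / 2) h * poch (s + (1 - b - 2 * h) / 2) h := by
  obtain ⟨d, hd⟩ := Nat.exists_eq_add_of_le hs
  have hsub : h - s = d := by omega
  set y := (b - 2 * h - 1 + a) / 4 + ((h : ℝ) - s) with hy
  have hr : range (h + 1) = range (s + d + 1) := by rw [hd]
  have hfac : nodePoly h a b * nodePoly h (-a) b = (X - Polynomial.C y) *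
      (((∏ i ∈ range s, (X - Polynomial.C ((b - 2 * h - 1 + a) / 4 + (h - i)))) *
        ∏ i ∈ range d, (X - Polynomial.C ((b - 2 * h - 1 + a) / 4 + (h - (s + 1 + i : ℕ))))) *
        -- Once the factor vanishing at `y` is pulled out, the derivative at `y` is the value of the
        -- cofactor, and each remaining product is a Pochhammer symbol.
        (∏ s ∈ range h, (X - Polynomial.C (-((b - 2 * h - 1 + a) / 4 + (h - s))))) *
        nodePoly h (-a) b) := by
    rw [nodePoly, hr, prod_range_split, ← hy]; simp only [mul_assoc]
  have p1 : ∏ i ∈ range s, (y - ((b - 2 * h - 1 + a) / 4 + (h - i))) = poch (-s) s := by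
    rw [poch_eq_prod]; exact prod_congr rfl fun i _ => by rw [hy]; ring
  have p2 : ∏ i ∈ range d, (y - ((b - 2 * h - 1 + a) / 4 + (h - (s + 1 + i : ℕ)))) = poch 1 d := by
    rw [poch_eq_prod]; exact prod_congr rfl fun i _ => by rw [hy]; push_cast; ring
  have p3 : ∏ i ∈ range h, (y - -((b - 2 * h - 1 + a) / 4 + (h - i))) =
      (-1) ^ h * poch (s + (1 - a - b - 2 * h) / 2) h := by
    rw [← prod_neg_add]; exact prod_congr rfl fun i _ => by rw [hy]; ring
  have p4 : ∏ i ∈ range (h + 1), (y - ((b - 2 * h - 1 + -a) / 4 + (h - i))) =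
      poch (-s + a / 2) (h + 1) := by
    rw [poch_eq_prod]; exact prod_congr rfl fun i _ => by rw [hy]; ring
  have p5 : ∏ i ∈ range h, (y - -((b - 2 * h - 1 + -a) / 4 + (h - i))) =
      (-1) ^ h * poch (s + (1 - b - 2 * h) / 2) h := by
    rw [← prod_neg_add]; exact prod_congr rfl fun i _ => by rw [hy]; ring
  have hsq : ((-1 : ℝ) ^ h) * (-1) ^ h = 1 := by rw [← mul_pow]; simp
  rw [hfac, eval_derivative_X_sub_C_mul, nodePoly, hsub]
  simp only [eval_mul, eval_prod, eval_sub, eval_X, eval_C]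
  rw [p1, p2, p3, p4, p5]
  linear_combination poch (-s) s * poch 1 d * poch (-s + a / 2) (h + 1) *
        poch (s + (1 - a - b - 2 * h) / 2) h * poch (s + (1 - b - 2 * h) / 2) h * hsq

theorem eval_derivative_second {s : ℕ} (hs : s < h) :
    (derivative (nodePoly h a b * nodePoly h (-a) b)).eval
        (-((b - 2 * h - 1 + a) / 4 + (h - s))) =
      -(poch (-s) s * poch 1 (h - s - 1) * poch (-s + a / 2) h *
        poch (s + (1 - a - b - 2 * h) / 2) (h + 1) * poch (s + (1 - b - 2 * h) / 2) (h + 1)) := by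
  obtain ⟨d, hd⟩ := Nat.exists_eq_add_of_lt hs
  have hsub : h - s - 1 = d := by omega
  set y := -((b - 2 * h - 1 + a) / 4 + ((h : ℝ) - s)) with hy
  have hr : range h = range (s + d + 1) := by rw [hd]
  have hfac : nodePoly h a b * nodePoly h (-a) b = (X - Polynomial.C y) *
      ((∏ s ∈ range (h + 1), (X - Polynomial.C ((b - 2 * h - 1 + a) / 4 + (h - s)))) *
      ((∏ i ∈ range s, (X - Polynomial.C (-((b - 2 * h - 1 + a) / 4 + (h - i))))) *
        ∏ i ∈ range d, (X - Polynomial.C (-((b - 2 * h - 1 + a) / 4 + (h - (s + 1 + i : ℕ)))))) *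
        nodePoly h (-a) b) := by
    rw [nodePoly]
    conv_lhs => enter [1, 2]; rw [hr]
    rw [prod_range_split, ← hy]; ring
  have p1 : ∏ i ∈ range s, (y - -((b - 2 * h - 1 + a) / 4 + (h - i))) =
      (-1) ^ s * poch (-s) s := by
    rw [← prod_neg_add]; exact prod_congr rfl fun i _ => by rw [hy]; ring
  have p2 : ∏ i ∈ range d, (y - -((b - 2 * h - 1 + a) / 4 + (h - (s + 1 + i : ℕ)))) =
      (-1) ^ d * poch 1 d := by
    rw [← prod_neg_add]; exact prod_congr rfl fun i _ => by rw [hy]; push_cast; ring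
  have p3 : ∏ i ∈ range (h + 1), (y - ((b - 2 * h - 1 + a) / 4 + (h - i))) =
      poch (s + (1 - a - b - 2 * h) / 2) (h + 1) := by
    rw [poch_eq_prod]; exact prod_congr rfl fun i _ => by rw [hy]; ring
  have p4 : ∏ i ∈ range h, (y - -((b - 2 * h - 1 + -a) / 4 + (h - i))) =
      (-1) ^ h * poch (-s + a / 2) h := by
    rw [← prod_neg_add]; exact prod_congr rfl fun i _ => by rw [hy]; ring
  have p5 : ∏ i ∈ range (h + 1), (y - ((b - 2 * h - 1 + -a) / 4 + (h - i))) =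
      poch (s + (1 - b - 2 * h) / 2) (h + 1) := by
    rw [poch_eq_prod]; exact prod_congr rfl fun i _ => by rw [hy]; ring
  -- The exponent is `2(s + d) + 1`; this is the source of the opposite signs of `weight2` and
  -- `weight3`.
  have hsq : ((-1 : ℝ) ^ h) * ((-1) ^ s * (-1) ^ d) = -1 := by
    rw [hd, ← pow_add, ← pow_add]
    exact Odd.neg_one_pow ⟨s + d, by ring⟩
  rw [hfac, eval_derivative_X_sub_C_mul, nodePoly, hsub]
  simp only [eval_mul, eval_prod, eval_sub, eval_X, eval_C]
  rw [p1, p2, p3, p4, p5]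
  linear_combination poch (-s) s * poch 1 d * poch (-s + a / 2) h *
        poch (s + (1 - a - b - 2 * h) / 2) (h + 1) * poch (s + (1 - b - 2 * h) / 2) (h + 1) * hsq

/-! ### Norms -/

theorem uProd_eq (j : ℕ) (a b α : ℝ) (n : ℕ) :
    uProd j a b α n = ∏ i ∈ range n, coeffA1 j a b α i * coeffC1 j a b α (i + 1) := by
  rw [uProd, ← Finset.Ico_add_one_right_eq_Icc, prod_Ico_eq_prod_range]
  refine prod_congr (by simp) fun i _ => ?_
  rw [u, show 1 + i - 1 = i by omega, add_comm 1 i]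

theorem uProd_zero (j : ℕ) (a b α : ℝ) : uProd j a b α 0 = 1 := by simp [uProd_eq]

theorem uProd_succ (j : ℕ) (a b α : ℝ) (n : ℕ) :
    uProd j a b α (n + 1) =
      uProd j a b α n * (coeffA1 j a b α n * coeffC1 j a b α (n + 1)) := by
  rw [uProd_eq, prod_range_succ, ← uProd_eq]

theorem coeffA1_mul_coeffC1_of_ne (j : ℕ) (a b α α' : ℝ) {i : ℕ} (hi : i ≠ j) :
    coeffA1 j a b α i * coeffC1 j a b α (i + 1) =
      coeffA1 j a b α' i * coeffC1 j a b α' (i + 1) := by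
  rw [coeffA1, coeffA1, coeffC1, coeffC1]
  simp [hi]

theorem coeffA1_mul_coeffC1_self {j : ℕ} (hj : Even j) (a b α : ℝ) :
    coeffA1 j a b α j * coeffC1 j a b α (j + 1) = α * (1 - α) * (a / 2) ^ 2 := by
  rw [coeffA1_self _ _ _ hj, coeffC1_self _ _ _ hj]; ring

/-- Only the factor with index `j + 1` depends on `α`, and it is `4α(1 - α)` times its value at `α =
1/2`. -/
theorem uProd_eq_half {j : ℕ} (hj : Even j) (a b α : ℝ) (n : ℕ) :
    uProd j a b α n = uProd j a b (1 / 2) n * (if n ≤ j then 1 else 4 * (α * (1 - α))) := by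
  induction n with
  | zero => simp [uProd_zero]
  | succ n ih =>
    rw [uProd_succ, uProd_succ, ih]
    by_cases hn : n = j
    · subst hn
      rw [coeffA1_mul_coeffC1_self hj, coeffA1_mul_coeffC1_self hj, if_pos le_rfl,
        if_neg (by omega)]
      ring
    · rw [coeffA1_mul_coeffC1_of_ne j a b α (1 / 2) hn]
      have : (n + 1 ≤ j) ↔ n ≤ j := by omega
      simp only [this]
      ring

variable {α : ℝ}

theorem two_mul_add_one_sub_ne_zero (n h : ℕ) : (2 * n + 1 - 2 * h : ℝ) ≠ 0 := by
  intro e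
  have e' : (2 * n + 1 : ℝ) = 2 * h := by linarith
  have : 2 * n + 1 = 2 * h := by exact_mod_cast e'
  omega

theorem half_coeff_even (h : ℕ) (a b : ℝ) (n : ℕ) :
    coeffA1 (2 * h) a b (1 / 2) (2 * n) * coeffC1 (2 * h) a b (1 / 2) (2 * n + 1) =
      -(1 / 16) * ((2 * n - 2 * h + a) * (2 * n - 2 * h - a)) := by
  by_cases hn : n = h
  · subst hn
    rw [coeffA1_mul_coeffC1_self (even_two_mul n)]; ring
  · rw [coeffA1_even _ _ _ _ (even_two_mul n) (by omega),
      coeffC1_odd _ _ _ _ (by simp [parity_simps]) (by omega)]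
    push_cast; ring

theorem coeff_odd (h : ℕ) (a b α : ℝ) (n : ℕ) :
    coeffA1 (2 * h) a b α (2 * n + 1) * coeffC1 (2 * h) a b α (2 * n + 2) =
      (1 / 16) * ((4 * h - 2 * n) * (2 * n + 2) * ((2 * n + 1 - 2 * h) ^ 2 - b ^ 2) /
        (2 * n + 1 - 2 * h) ^ 2) := by
  have d := two_mul_add_one_sub_ne_zero n h
  rw [coeffA1_odd _ _ _ _ (by simp [parity_simps]),
    coeffC1_even _ _ _ _ (by simp [parity_simps])]
  push_cast
  rw [show (2 * n + 2 - 2 * h - 1 : ℝ) = 2 * n + 1 - 2 * h by ring]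
  field_simp
  ring

theorem uProd_half_closed (h : ℕ) (a b : ℝ) (n : ℕ) :
    uProd (2 * h) a b (1 / 2) (2 * n) * (2 ^ (2 * n) * poch ((1 - (2 * h : ℕ)) / 2) n) ^ 2 =
        poch (-(2 * h : ℕ)) n * poch 1 n * poch ((1 - b - (2 * h : ℕ)) / 2) n *
          poch ((1 + b - (2 * h : ℕ)) / 2) n * poch (-(((2 * h : ℕ) + a) / 2)) n *
          poch (-(((2 * h : ℕ) - a) / 2)) n ∧
      uProd (2 * h) a b (1 / 2) (2 * n + 1) *
          (2 ^ (2 * n + 1) * poch ((1 - (2 * h : ℕ)) / 2) n) ^ 2 =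
        (-1) * poch (-(2 * h : ℕ)) n * poch 1 n * poch ((1 - b - (2 * h : ℕ)) / 2) n *
          poch ((1 + b - (2 * h : ℕ)) / 2) n * poch (-(((2 * h : ℕ) + a) / 2)) (n + 1) *
          poch (-(((2 * h : ℕ) - a) / 2)) (n + 1) := by
  have step : ∀ n, uProd (2 * h) a b (1 / 2) (2 * n) *
        (2 ^ (2 * n) * poch ((1 - (2 * h : ℕ)) / 2) n) ^ 2 =
        poch (-(2 * h : ℕ)) n * poch 1 n * poch ((1 - b - (2 * h : ℕ)) / 2) n *
          poch ((1 + b - (2 * h : ℕ)) / 2) n * poch (-(((2 * h : ℕ) + a) / 2)) n *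
          poch (-(((2 * h : ℕ) - a) / 2)) n →
      uProd (2 * h) a b (1 / 2) (2 * n + 1) *
          (2 ^ (2 * n + 1) * poch ((1 - (2 * h : ℕ)) / 2) n) ^ 2 =
        (-1) * poch (-(2 * h : ℕ)) n * poch 1 n * poch ((1 - b - (2 * h : ℕ)) / 2) n *
          poch ((1 + b - (2 * h : ℕ)) / 2) n * poch (-(((2 * h : ℕ) + a) / 2)) (n + 1) *
          poch (-(((2 * h : ℕ) - a) / 2)) (n + 1) := by
    intro n hn
    rw [uProd_succ, half_coeff_even, poch_succ, poch_succ, pow_succ]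
    push_cast at hn ⊢
    linear_combination -(1 / 4) * ((2 * n - 2 * h + a) * (2 * n - 2 * h - a)) * hn
  induction n with
  | zero =>
    refine ⟨by simp [uProd_zero, poch_zero], step 0 (by simp [uProd_zero, poch_zero])⟩
  | succ n ih =>
    suffices hs : _ from ⟨hs, step (n + 1) hs⟩
    have ih := ih.2
    have d := two_mul_add_one_sub_ne_zero n h
    rw [show 2 * (n + 1) = 2 * n + 1 + 1 by ring, uProd_succ, coeff_odd, pow_succ,
      poch_succ ((1 - (2 * h : ℕ)) / 2), poch_succ (-(2 * h : ℕ)), poch_succ 1,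
      poch_succ ((1 - b - (2 * h : ℕ)) / 2), poch_succ ((1 + b - (2 * h : ℕ)) / 2)]
    push_cast at ih ⊢
    have e : (2 * ((1 - 2 * h) / 2 + n : ℝ)) = 2 * n + 1 - 2 * h := by ring
    have key : (1 / 16) * ((4 * h - 2 * n) * (2 * n + 2) * ((2 * n + 1 - 2 * h) ^ 2 - b ^ 2) /
        (2 * n + 1 - 2 * h) ^ 2) * (2 * ((1 - 2 * h) / 2 + n : ℝ)) ^ 2 =
        (1 / 16) * ((4 * h - 2 * n) * (2 * n + 2) * ((2 * n + 1 - 2 * h) ^ 2 - b ^ 2)) := by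
      rw [e]
      generalize (2 * n + 1 - 2 * h : ℝ) = w at *
      field_simp
    linear_combination uProd (2 * h) a b (1 / 2) (2 * n + 1) *
      (2 ^ (2 * n + 1) * poch ((1 - 2 * h) / 2) n) ^ 2 * key +
      (1 / 16) * ((4 * h - 2 * n) * (2 * n + 2) * ((2 * n + 1 - 2 * h) ^ 2 - b ^ 2)) * ih

theorem poch_half_ne_zero (h n : ℕ) : poch ((1 - (2 * h : ℕ)) / 2) n ≠ 0 := by
  refine poch_ne_zero fun i _ e => two_mul_add_one_sub_ne_zero i h ?_
  push_cast at e
  linarith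

/-- For even `i` the sign is that of `a² - (2n - 2h)²`, with `|2n - 2h| ≤ 2h < |a|`; for odd `i` it
is that of the square of an odd integer minus `b²`. -/
theorem half_coeff_pos (ha : (2 * h : ℝ) + 1 ≤ |a|) (hb' : 0 < h → |b| < 1) {i : ℕ}
    (hi : i < 4 * h + 1) :
    0 < coeffA1 (2 * h) a b (1 / 2) i * coeffC1 (2 * h) a b (1 / 2) (i + 1) := by
  have hh : (0 : ℝ) ≤ h := by positivity
  rcases Nat.even_or_odd' i with ⟨n, rfl | rfl⟩
  · rw [half_coeff_even]
    have h1 : (n : ℝ) ≤ 2 * h := by exact_mod_cast (by omega : n ≤ 2 * h)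
    have h0 : (0 : ℝ) ≤ n := by positivity
    have : |(2 * n - 2 * h : ℝ)| < |a| := by
      refine lt_of_le_of_lt (abs_le.2 ⟨?_, ?_⟩) (lt_of_lt_of_le (lt_add_one (2 * h : ℝ)) ha) <;>
        linarith
    have := sq_lt_sq.2 this
    nlinarith
  · rw [coeff_odd]
    have hn : n < 2 * h := by omega
    have h1 : (n : ℝ) + 1 ≤ 2 * h := by exact_mod_cast hn
    have h0 : (0 : ℝ) ≤ n := by positivity
    have d := two_mul_add_one_sub_ne_zero n h
    have hz : (1 : ℝ) ≤ |2 * (n : ℝ) + 1 - 2 * (h : ℝ)| := by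
      have : (1 : ℤ) ≤ |2 * (n : ℤ) + 1 - 2 * (h : ℤ)| := Int.one_le_abs (by omega)
      exact_mod_cast this
    have hlt := sq_lt_sq.2 (lt_of_lt_of_le (hb' (by omega)) hz)
    have p1 : (0 : ℝ) < (2 * n + 1 - 2 * h) ^ 2 := by positivity
    have p2 : (0 : ℝ) < (2 * n + 1 - 2 * h) ^ 2 - b ^ 2 := by linarith
    have p3 : (0 : ℝ) < 4 * h - 2 * n := by linarith
    have p4 : (0 : ℝ) < 2 * n + 2 := by linarith
    positivity

theorem coeff_pos (ha : (2 * h : ℝ) + 1 ≤ |a|) (hb' : 0 < h → |b| < 1) (hα0 : 0 < α)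
    (hα1 : α < 1) {i : ℕ} (hi : i < 4 * h + 1) :
    0 < coeffA1 (2 * h) a b α i * coeffC1 (2 * h) a b α (i + 1) := by
  by_cases e : i = 2 * h
  · subst e
    rw [coeffA1_mul_coeffC1_self (even_two_mul h)]
    have : a ≠ 0 := by
      rintro rfl
      rw [abs_zero] at ha
      have : (0 : ℝ) ≤ h := by positivity
      linarith
    have := sub_pos.2 hα1
    positivity
  · rw [coeffA1_mul_coeffC1_of_ne _ _ _ α (1 / 2) e]
    exact half_coeff_pos ha hb' hi

theorem uProd_pos (ha : (2 * h : ℝ) + 1 ≤ |a|) (hb' : 0 < h → |b| < 1) (hα0 : 0 < α)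
    (hα1 : α < 1) {n : ℕ} (hn : n ≤ 4 * h + 1) : 0 < uProd (2 * h) a b α n := by
  rw [uProd_eq]
  exact prod_pos fun i hi => coeff_pos ha hb' hα0 hα1 (by have := mem_range.1 hi; omega)

theorem hNorm_sq (ha : (2 * h : ℝ) + 1 ≤ |a|) (hb' : 0 < h → |b| < 1) (hα0 : 0 ≤ α)
    (hα1 : α ≤ 1) {n : ℕ} (hn : n ≤ 4 * h + 1) :
    hNorm (2 * h) a b α n ^ 2 = uProd (2 * h) a b α n := by
  have hp : 0 < uProd (2 * h) a b (1 / 2) n :=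
    uProd_pos ha hb' (by norm_num) (by norm_num) hn
  have hs : √(α * (1 - α)) ^ 2 = α * (1 - α) :=
    Real.sq_sqrt (mul_nonneg hα0 (sub_nonneg.2 hα1))
  rw [uProd_eq_half (even_two_mul h)]
  rcases Nat.even_or_odd' n with ⟨m, rfl | rfl⟩
  · have hc := (uProd_half_closed h a b m).1
    have hd : (2 ^ (2 * m) * poch ((1 - (2 * h : ℕ)) / 2) m) ≠ 0 :=
      mul_ne_zero (by positivity) (poch_half_ne_zero h m)
    have hi : (m ≤ 2 * h / 2) ↔ 2 * m ≤ 2 * h := by omega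
    rw [hNorm, if_pos (even_two_mul m), Nat.mul_div_cancel_left _ two_pos, hEven, mul_pow,
      div_pow, ← hc, Real.sq_sqrt (by positivity), mul_div_cancel_right₀ _ (pow_ne_zero 2 hd)]
    simp only [hi]
    split_ifs
    · simp
    · rw [mul_pow, hs]; norm_num
  · have hc := (uProd_half_closed h a b m).2
    have hd : (2 ^ (2 * m + 1) * poch ((1 - (2 * h : ℕ)) / 2) m) ≠ 0 :=
      mul_ne_zero (by positivity) (poch_half_ne_zero h m)
    have hi : (m < 2 * h / 2) ↔ 2 * m + 1 ≤ 2 * h := by omega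
    rw [hNorm, if_neg (by simp [parity_simps]), show (2 * m + 1) / 2 = m by omega, hOdd, mul_pow,
      div_pow, ← hc, Real.sq_sqrt (by positivity), mul_div_cancel_right₀ _ (pow_ne_zero 2 hd)]
    simp only [hi]
    split_ifs
    · simp
    · rw [mul_pow, hs]; norm_num

/-- Each long Pochhammer symbol is split in the middle and one half reflected, which reproduces the
closed form of the norm in degree `j`. The unpaired middle factor of the symbol of length `j + 1` is
`-a/2`. -/
theorem hTop_eq (h : ℕ) (a b : ℝ) :
    hTop (2 * h) a b = -(a / 4) * uProd (2 * h) a b (1 / 2) (2 * h) := by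
  have hc := (uProd_half_closed h a b h).1
  have q1 := poch_add 1 h h
  have q2 := poch_reflect (-(2 * h : ℕ)) h
  have q3 := poch_add ((1 - b - (2 * h : ℕ)) / 2) h h
  have q4 := poch_reflect ((1 + b - (2 * h : ℕ)) / 2) h
  have q5 := poch_add (-(((2 * h : ℕ) + a) / 2)) h (1 + h)
  have q6 := poch_add (-(((2 * h : ℕ) + a) / 2) + h) 1 h
  have q7 := poch_reflect (-(((2 * h : ℕ) - a) / 2)) h
  have q8 := poch_add ((1 - (2 * h : ℕ)) / 2) h h
  have q9 := poch_reflect ((1 - (2 * h : ℕ)) / 2) h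
  have q10 : poch (-(((2 * h : ℕ) + a) / 2) + h) 1 = -(a / 2) := by
    rw [poch_succ, poch_zero]; push_cast; ring
  rw [show (1 : ℝ) - -(2 * h : ℕ) - h = 1 + h by push_cast; ring] at q2
  rw [show (1 : ℝ) - (1 + b - (2 * h : ℕ)) / 2 - h = (1 - b - (2 * h : ℕ)) / 2 + h by
    push_cast; ring] at q4
  rw [show (1 : ℝ) - -(((2 * h : ℕ) - a) / 2) - h = -(((2 * h : ℕ) + a) / 2) + h + (1 : ℕ) by
    push_cast; ring] at q7
  rw [show (1 : ℝ) - (1 - (2 * h : ℕ)) / 2 - h = (1 - (2 * h : ℕ)) / 2 + h by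
    push_cast; ring] at q9
  have hd := poch_half_ne_zero h h
  have hd2 := poch_half_ne_zero h (2 * h)
  have hsq : ((-1 : ℝ) ^ h) * (-1) ^ h = 1 := by rw [← mul_pow]; simp
  have hpow : (2 : ℝ) ^ (2 * (2 * h) + 1) = 2 * (2 ^ (2 * h)) ^ 2 := by ring
  rw [q2, q4, q7, mul_pow] at hc
  rw [hTop, div_eq_iff (mul_ne_zero (by positivity) hd2), hpow]
  rw [show 2 * h + 1 = h + (1 + h) by ring, q5, q6, q10]
  rw [← two_mul] at q1 q3 q8
  rw [q1, q3, q8]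
  generalize hP : poch ((1 - (2 * h : ℕ)) / 2) h = P at *
  generalize hQ : poch ((1 - (2 * h : ℕ)) / 2 + h) h = Q at *
  have hQ' : Q = (-1) ^ h * P := by rw [q9, ← mul_assoc, hsq, one_mul]
  rw [hQ']
  generalize (-1 : ℝ) ^ h = e at *
  generalize uProd (2 * h) a b (1 / 2) (2 * h) = U at *
  generalize (2 : ℝ) ^ (2 * h) = t at *
  generalize poch 1 h = x1 at *
  generalize poch (1 + h) h = x2 at *
  generalize poch ((1 - b - (2 * h : ℕ)) / 2) h = x3 at *
  generalize poch ((1 - b - (2 * h : ℕ)) / 2 + h) h = x4 at *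
  generalize poch (-(((2 * h : ℕ) + a) / 2)) h = x5 at *
  generalize poch (-(((2 * h : ℕ) + a) / 2) + h + (1 : ℕ)) h = x6 at *
  linear_combination (a / 2) * e * hc + (a / 2) * x1 * x2 * x3 * x4 * x5 * x6 * (e * e + 1) * hsq

/-! ### Nonvanishing -/

theorem not_odd_of_abs_lt_one (hb : |b| < 1) (z : ℤ) : b ≠ 2 * z + 1 := by
  intro e
  have : (1 : ℤ) ≤ |2 * z + 1| := Int.one_le_abs (by omega)
  have : (1 : ℝ) ≤ |2 * (z : ℝ) + 1| := by exact_mod_cast this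
  rw [← e] at this
  linarith

theorem half_add_ne_zero (ha : (2 * h : ℝ) + 1 ≤ |a|) {t : ℝ} (ht : |t| ≤ h) : t + a / 2 ≠ 0 := by
  intro e
  have : a = -(2 * t) := by linarith
  rw [this, abs_neg, abs_mul, abs_two] at ha
  linarith

theorem poch_b_ne_zero (hb' : 0 < h → |b| < 1) (s k : ℕ) (hk : k ≠ 0 → 0 < h) :
    poch (s + (1 - b - 2 * h) / 2) k ≠ 0 := by
  refine poch_ne_zero fun i hi e => not_odd_of_abs_lt_one (hb' (hk (by omega))) (s + i - h) ?_
  push_cast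
  linarith

theorem poch_a_ne_zero (ha : (2 * h : ℝ) + 1 ≤ |a|) {s k : ℕ} (hs : s ≤ h) (hk : k ≤ h + 1) :
    poch (-s + a / 2) k ≠ 0 := by
  refine poch_ne_zero fun i hi e => half_add_ne_zero (t := i - s) ha ?_ (by linarith)
  have h1 : (i : ℝ) ≤ h := by exact_mod_cast (by omega : i ≤ h)
  have h2 : (s : ℝ) ≤ h := by exact_mod_cast hs
  have h3 : (0 : ℝ) ≤ i := by positivity
  have h4 : (0 : ℝ) ≤ s := by positivity
  exact abs_le.2 ⟨by linarith, by linarith⟩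

theorem poch_ab_ne_zero (ha : (2 * h : ℝ) + 1 ≤ |a|) (hb' : 0 < h → |b| < 1)
    {s k : ℕ} (hsk : s + k ≤ 2 * h) :
    poch (s + (1 - a - b - 2 * h) / 2) k ≠ 0 := by
  refine poch_ne_zero fun i hi e => ?_
  have h1 : (s : ℝ) + i + 1 ≤ 2 * h := by exact_mod_cast (by omega : s + i + 1 ≤ 2 * h)
  have h3 : (0 : ℝ) ≤ i := by positivity
  have h4 : (0 : ℝ) ≤ s := by positivity
  have hb2 := abs_lt.1 (hb' (by omega))
  rcases le_abs.1 ha with h5 | h5 <;> linarith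

theorem poch_neg_ne_zero (s : ℕ) : poch (-s) s ≠ 0 := by
  refine poch_ne_zero fun i hi e => ?_
  have h1 : (i : ℝ) < s := by exact_mod_cast hi
  linarith

theorem poch_one_ne_zero (s : ℕ) : poch 1 s ≠ 0 :=
  poch_ne_zero fun i _ => by positivity

theorem denominator_first_ne_zero (ha : (2 * h : ℝ) + 1 ≤ |a|)
    (hb' : 0 < h → |b| < 1) {s : ℕ} (hs : s ≤ h) :
    poch (-s) s * poch 1 (h - s) * poch (-s + a / 2) (h + 1) *
        poch (s + (1 - a - b - 2 * h) / 2) h * poch (s + (1 - b - 2 * h) / 2) h ≠ 0 :=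
  mul_ne_zero (mul_ne_zero (mul_ne_zero (mul_ne_zero (poch_neg_ne_zero s) (poch_one_ne_zero _))
    (poch_a_ne_zero ha hs le_rfl)) (poch_ab_ne_zero ha hb' (by omega)))
    (poch_b_ne_zero hb' s h (by omega))

theorem denominator_second_ne_zero (ha : (2 * h : ℝ) + 1 ≤ |a|)
    (hb' : 0 < h → |b| < 1) {s : ℕ} (hs : s < h) :
    poch (-s) s * poch 1 (h - s - 1) * poch (-s + a / 2) h *
        poch (s + (1 - a - b - 2 * h) / 2) (h + 1) * poch (s + (1 - b - 2 * h) / 2) (h + 1) ≠ 0 :=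
  mul_ne_zero (mul_ne_zero (mul_ne_zero (mul_ne_zero (poch_neg_ne_zero s) (poch_one_ne_zero _))
    (poch_a_ne_zero ha hs.le (by omega))) (poch_ab_ne_zero ha hb' (by omega)))
    (poch_b_ne_zero hb' s (h + 1) (by omega))

/-! ### Values of the mirrored polynomial on the lattice and the weights -/

theorem P1_zero_middle_eq (ha : (2 * h : ℝ) + 1 ≤ |a|) (hb' : 0 < h → |b| < 1) :
    P1 (2 * h) a b 0 (2 * h + 1) = nodePoly h a b := by
  refine P1_zero_middle (fun i hi e => ?_) fun i hi e => ?_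
  · refine half_add_ne_zero (t := i + 1 - h) ha ?_ (by linarith)
    have h1 : (i : ℝ) + 1 ≤ h := by exact_mod_cast hi
    have h3 : (0 : ℝ) ≤ i := by positivity
    exact abs_le.2 ⟨by linarith, by linarith⟩
  · refine not_odd_of_abs_lt_one (hb' (by omega)) (h - i - 1) ?_
    push_cast
    linarith

theorem P1_top (ha : (2 * h : ℝ) + 1 ≤ |a|) (hb' : 0 < h → |b| < 1) :
    P1 (2 * h) a b α (4 * h + 2) = nodePoly h a b * nodePoly h (-a) b := by
  have := P1_top_mul (even_two_mul h) a b α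
  rw [P1_zero_middle_eq ha hb', P1_zero_middle_eq (by rwa [abs_neg]) hb'] at this
  rw [← this]; congr 1; ring

theorem nodePoly_neg (ha : (2 * h : ℝ) + 1 ≤ |a|) (hb' : 0 < h → |b| < 1) :
    nodePoly h (-a) b = nodePoly h a b + Polynomial.C (a / 2) * P1 (2 * h) a b α (2 * h) := by
  rw [← P1_zero_middle_eq ha hb', ← P1_zero_middle_eq (by rwa [abs_neg]) hb',
    P1_middle_neg (even_two_mul h), P1_congr _ _ _ α 0]

theorem P1_middle_eq (ha : (2 * h : ℝ) + 1 ≤ |a|) (hb' : 0 < h → |b| < 1) :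
    P1 (2 * h) a b (1 - α) (2 * h + 1) = nodePoly h a b +
      Polynomial.C ((1 - α) * a / 2) * P1 (2 * h) a b α (2 * h) := by
  rw [P1_middle (even_two_mul h) a b (1 - α) 0, P1_zero_middle_eq ha hb', P1_congr _ _ _ α (1 - α),
    sub_zero]

/-- The mirrored polynomial of degree `N` takes only two values on the lattice. -/
theorem eval_mirror_top {x : ℝ} {c : ℝ}
    (hx : (P1 (2 * h) a b α (4 * h + 2)).eval x = 0)
    (hP : (P1 (2 * h) a b α (2 * h)).eval x ≠ 0)
    (hc : (P1 (2 * h) a b (1 - α) (2 * h + 1)).eval x =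
      c * (P1 (2 * h) a b α (2 * h)).eval x) :
    (P1 (2 * h) a b (1 - α) (4 * h + 1)).eval x = c * uProd (2 * h) a b (1 / 2) (2 * h) := by
  have hN : 4 * h + 1 = 2 * (2 * h) + 1 := by ring
  have := eval_recPoly_mul_mirror (r := rho1 (2 * h) a b)
    (coeffA1_mirror (even_two_mul h) a b α) (coeffC1_mirror (even_two_mul h) a b α)
    (by rw [← hN]; exact hx) (2 * h) (2 * h + 1) (by ring)
  rw [← hN, ← P1, ← P1, ← P1, ← uProd_eq, hc, uProd_eq_half (even_two_mul h), if_pos le_rfl] at this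
  apply mul_left_cancel₀ hP
  linarith

theorem eval_mirror_of_root (ha : (2 * h : ℝ) + 1 ≤ |a|) (hb' : 0 < h → |b| < 1) {x : ℝ}
    (hx : (nodePoly h a b).eval x = 0)
    (hd : (derivative (nodePoly h a b * nodePoly h (-a) b)).eval x ≠ 0) :
    (P1 (2 * h) a b (1 - α) (4 * h + 1)).eval x = -(2 * (1 - α) * hTop (2 * h) a b) := by
  have hT := congrArg (eval x) (nodePoly_neg (α := α) ha hb')
  have hM := congrArg (eval x) (P1_middle_eq (α := α) ha hb')
  simp only [eval_add, eval_mul, eval_C, hx, zero_add] at hT hM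
  -- At a root of the first factor the derivative of the product is its derivative times `(a/2) P`,
  -- so simplicity of the root forces the polynomial `P` of degree `j` not to vanish there.
  rw [derivative_mul] at hd
  simp only [eval_add, eval_mul, hx, zero_mul, add_zero, hT] at hd
  rw [eval_mirror_top (by rw [P1_top ha hb', eval_mul, hx, zero_mul])
    (right_ne_zero_of_mul (right_ne_zero_of_mul hd)) hM, hTop_eq]
  ring

theorem eval_mirror_of_root_neg (ha : (2 * h : ℝ) + 1 ≤ |a|) (hb' : 0 < h → |b| < 1) {x : ℝ}
    (hx : (nodePoly h (-a) b).eval x = 0)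
    (hd : (derivative (nodePoly h a b * nodePoly h (-a) b)).eval x ≠ 0) :
    (P1 (2 * h) a b (1 - α) (4 * h + 1)).eval x = 2 * α * hTop (2 * h) a b := by
  have hT := congrArg (eval x) (nodePoly_neg (α := α) ha hb')
  have hM := congrArg (eval x) (P1_middle_eq (α := α) ha hb')
  simp only [eval_add, eval_mul, eval_C, hx] at hT hM
  have hS : (nodePoly h a b).eval x = -(a / 2) * (P1 (2 * h) a b α (2 * h)).eval x := by linarith
  rw [derivative_mul] at hd
  simp only [eval_add, eval_mul, hx, mul_zero, zero_add, hS] at hd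
  rw [eval_mirror_top (c := -(α * a / 2)) (by rw [P1_top ha hb', eval_mul, hx, mul_zero])
    (right_ne_zero_of_mul (left_ne_zero_of_mul hd)) (by rw [hM, hS]; ring), hTop_eq]
  ring

theorem eval_nodePoly_first {s : ℕ} (hs : s ≤ h) :
    (nodePoly h a b).eval ((b - 2 * h - 1 + a) / 4 + (h - s)) = 0 := by
  rw [nodePoly, eval_mul, eval_prod,
    prod_eq_zero (mem_range.2 (Nat.lt_succ_of_le hs)) (by simp), zero_mul]

theorem eval_nodePoly_second {s : ℕ} (hs : s < h) :
    (nodePoly h a b).eval (-((b - 2 * h - 1 + a) / 4 + (h - s))) = 0 := by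
  rw [nodePoly, eval_mul, eval_prod, eval_prod, mul_comm,
    prod_eq_zero (mem_range.2 hs) (by simp), zero_mul]

/-- The weights, and the simplicity of the points of the lattice. -/
theorem weight_eq (ha : (2 * h : ℝ) + 1 ≤ |a|) (hb' : 0 < h → |b| < 1) {k : ℕ}
    (hk : k < 4 * h + 2) :
    (derivative (P1 (2 * h) a b α (4 * h + 2))).eval (grid (2 * h) a b k) ≠ 0 ∧
    weight (2 * h) a b α k = (P1 (2 * h) a b (1 - α) (4 * h + 1)).eval (grid (2 * h) a b k) /
      (derivative (P1 (2 * h) a b α (4 * h + 2))).eval (grid (2 * h) a b k) := by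
  have ha' : (2 * h : ℝ) + 1 ≤ |-a| := by rwa [abs_neg]
  have hdiv : 2 * h / 2 = h := by omega
  rw [P1_top ha hb']
  obtain ⟨s, i, hi, rfl⟩ : ∃ s i, i < 4 ∧ k = 4 * s + i := ⟨k / 4, k % 4, by omega, by omega⟩
  have hq : (4 * s + i) / 4 = s := by omega
  have hr : (4 * s + i) % 4 = i := by omega
  rw [weight, hq, hr]
  interval_cases i
  · have hd := eval_derivative_first (a := -a) (b := b) (by omega : s ≤ h)
    have hn := denominator_first_ne_zero ha' hb' (by omega : s ≤ h)
    rw [neg_neg, mul_comm (nodePoly h (-a) b), ← grid_four_mul] at hd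
    rw [← hd] at hn
    have hx := eval_nodePoly_first (a := -a) (b := b) (by omega : s ≤ h)
    rw [← grid_four_mul] at hx
    rw [add_zero]
    refine ⟨hn, ?_⟩
    rw [eval_mirror_of_root_neg ha hb' hx hn, hd, if_pos rfl, weight0, hdiv, neg_div,
      ← sub_eq_add_neg, sub_neg_eq_add]
    push_cast; rfl
  · have hd := eval_derivative_first (a := a) (b := b) (by omega : s ≤ h)
    have hn := denominator_first_ne_zero ha hb' (by omega : s ≤ h)
    rw [← grid_four_mul_add_one] at hd
    rw [← hd] at hn
    have hx := eval_nodePoly_first (a := a) (b := b) (by omega : s ≤ h)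
    rw [← grid_four_mul_add_one] at hx
    refine ⟨hn, ?_⟩
    rw [eval_mirror_of_root ha hb' hx hn, hd, if_neg one_ne_zero, if_pos rfl, weight1, hdiv,
      neg_div]
    push_cast; rfl
  · have hd := eval_derivative_second (a := -a) (b := b) (by omega : s < h)
    have hn := neg_ne_zero.2 (denominator_second_ne_zero ha' hb' (by omega : s < h))
    rw [neg_neg, mul_comm (nodePoly h (-a) b), ← grid_four_mul_add_two] at hd
    rw [← hd] at hn
    have hx := eval_nodePoly_second (a := -a) (b := b) (by omega : s < h)
    rw [← grid_four_mul_add_two] at hx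
    refine ⟨hn, ?_⟩
    rw [eval_mirror_of_root_neg ha hb' hx hn, hd, if_neg two_ne_zero, if_neg (by norm_num),
      if_pos rfl, weight2, hdiv, neg_div, ← sub_eq_add_neg, sub_neg_eq_add, div_neg]
    push_cast; rfl
  · have hd := eval_derivative_second (a := a) (b := b) (by omega : s < h)
    have hn := neg_ne_zero.2 (denominator_second_ne_zero ha hb' (by omega : s < h))
    rw [← grid_four_mul_add_three] at hd
    rw [← hd] at hn
    have hx := eval_nodePoly_second (a := a) (b := b) (by omega : s < h)
    rw [← grid_four_mul_add_three] at hx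
    refine ⟨hn, ?_⟩
    rw [eval_mirror_of_root ha hb' hx hn, hd, if_neg three_ne_zero, if_neg (by norm_num),
      if_neg (by norm_num), weight3, hdiv, neg_div_neg_eq]
    push_cast; rfl

/-! ### Distinct nodes, orthogonality and positivity -/

theorem P1_top_eq_prod (ha : (2 * h : ℝ) + 1 ≤ |a|) (hb' : 0 < h → |b| < 1) :
    P1 (2 * h) a b α (4 * h + 2) =
      ∏ s ∈ range (4 * h + 2), (X - Polynomial.C (grid (2 * h) a b s)) := by
  rw [P1_top ha hb', nodePoly_mul_nodePoly_neg]

/-- A repeated node would be a multiple root of the top polynomial, where the derivative vanishes;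
the explicit derivative does not. The choice `α = 0` is arbitrary. -/
theorem grid_injOn (ha : (2 * h : ℝ) + 1 ≤ |a|) (hb' : 0 < h → |b| < 1) :
    Set.InjOn (grid (2 * h) a b) (range (4 * h + 2)) := by
  intro k hk l hl hkl
  by_contra hne
  refine (weight_eq (α := 0) ha hb' (mem_range.1 hk)).1 ?_
  rw [P1_top_eq_prod ha hb', ← Lagrange.nodal_eq,
    Lagrange.eval_nodal_derivative_eval_node_eq hk, Lagrange.eval_nodal]
  exact prod_eq_zero (mem_erase.2 ⟨Ne.symm hne, hl⟩) (sub_eq_zero.2 hkl)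

theorem grid_last (h : ℕ) (a b : ℝ) :
    grid (2 * h) a b (4 * h + 1) = rho1 (2 * h) a b := by
  rw [grid_four_mul_add_one, rho1]; push_cast; ring

/-- Since `A` vanishes at `N`, the kernel identity reads `(X - ρ₁) P0 = P1` in the top degree, and
`ρ₁` is the last node. -/
theorem P0_top_eq_prod (ha : (2 * h : ℝ) + 1 ≤ |a|) (hb' : 0 < h → |b| < 1) :
    P0 (2 * h) a b α (4 * h + 1) =
      ∏ s ∈ range (4 * h + 1), (X - Polynomial.C (grid (2 * h) a b s)) := by
  have h0 : coeffA1 (2 * h) a b α (4 * h + 1) = 0 := by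
    rw [coeffA1_odd _ _ _ _ (by simp [parity_simps])]
    push_cast; ring
  have := X_sub_C_mul_P0 (2 * h) a b α (4 * h + 1)
  rw [h0, map_zero, zero_mul, sub_zero, P1_top_eq_prod ha hb', prod_range_succ _ (4 * h + 1),
    grid_last, mul_comm] at this
  exact mul_right_cancel₀ (X_sub_C_ne_zero _) this

theorem orthogonality (ha : (2 * h : ℝ) + 1 ≤ |a|) (hb' : 0 < h → |b| < 1)
    {n m : ℕ} (hn : n ≤ 4 * h + 1) (hm : m ≤ 4 * h + 1) :
    ∑ s ∈ range (4 * h + 2), weight (2 * h) a b α s *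
        (P1 (2 * h) a b α n).eval (grid (2 * h) a b s) *
        (P1 (2 * h) a b α m).eval (grid (2 * h) a b s) =
      if n = m then uProd (2 * h) a b α n else 0 := by
  have hN : 4 * h + 1 = 2 * (2 * h) + 1 := by ring
  rw [uProd_eq]
  exact sum_recPoly_mul_recPoly (N := 4 * h + 1)
    (fun n m e => coeffA1_mirror (even_two_mul h) a b α n m (by omega))
    (fun n m e => coeffC1_mirror (even_two_mul h) a b α n m (by omega))
    (grid_injOn ha hb') (P1_top_eq_prod ha hb')
    (fun s hs => (weight_eq ha hb' hs).2) hn hm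

theorem weight_pos (ha : (2 * h : ℝ) + 1 ≤ |a|) (hb' : 0 < h → |b| < 1)
    (hα0 : 0 < α) (hα1 : α < 1) {s : ℕ} (hs : s < 4 * h + 2) :
    0 < weight (2 * h) a b α s :=
  weight_pos_of_orthogonal (c := uProd (2 * h) a b α)
    (p := fun n s => (P1 (2 * h) a b α n).eval (grid (2 * h) a b s))
    (fun _ hn => uProd_pos ha hb' hα0 hα1 (Nat.le_of_lt_succ hn))
    (fun _ _ hn hm => orthogonality ha hb' (Nat.le_of_lt_succ hn) (Nat.le_of_lt_succ hm)) s hs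

/-- The product of the two polynomials of degree `N` is constant on the lattice. -/
theorem eval_top_mul_mirror (ha : (2 * h : ℝ) + 1 ≤ |a|) (hb' : 0 < h → |b| < 1) {s : ℕ}
    (hs : s < 4 * h + 2) :
    (P1 (2 * h) a b α (4 * h + 1)).eval (grid (2 * h) a b s) *
      (P1 (2 * h) a b (1 - α) (4 * h + 1)).eval (grid (2 * h) a b s) =
        uProd (2 * h) a b α (4 * h + 1) := by
  have hx : (P1 (2 * h) a b α (4 * h + 1 + 1)).eval (grid (2 * h) a b s) = 0 := by
    rw [P1_top_eq_prod ha hb', ← Lagrange.nodal_eq,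
      Lagrange.eval_nodal_at_node (mem_range.2 hs)]
  have := eval_recPoly_mul_mirror (N := 4 * h + 1)
    (fun n m e => coeffA1_mirror (even_two_mul h) a b α n m (by omega))
    (fun n m e => coeffC1_mirror (even_two_mul h) a b α n m (by omega)) hx (4 * h + 1) 0 (by ring)
  rwa [← P1, ← P1, ← uProd_eq, recPoly_zero, eval_one, mul_one] at this

theorem hTop_sq (ha : (2 * h : ℝ) + 1 ≤ |a|) (hb' : 0 < h → |b| < 1) :
    hTop (2 * h) a b ^ 2 = uProd (2 * h) a b (1 / 2) (4 * h + 1) := by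
  -- At `α = 1/2` the polynomial of degree `N` is its own mirror, so its square at any node is the
  -- top norm; at node `0` its value is `hTop`.
  have h1 := eval_top_mul_mirror (α := 1 / 2) (s := 0) ha hb' (by omega)
  have h2 := (weight_eq (α := 1 / 2) ha hb' (by omega : 0 < 4 * h + 2)).1
  have hx := eval_nodePoly_first (a := -a) (b := b) (Nat.zero_le h)
  rw [← grid_four_mul, mul_zero] at hx
  rw [P1_top ha hb'] at h2
  have h3 := eval_mirror_of_root_neg (α := 1 / 2) ha hb' hx h2
  rw [show (1 : ℝ) - 1 / 2 = 1 / 2 by norm_num] at h1 h3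
  rw [← h1, h3]; ring

end ParaBannaiIto

theorem mainTheorem7 (j : ℕ) (hj : Even j) (a b α : ℝ)
    (ha : (j : ℝ) + 1 ≤ |a|) (hb : |b| ≤ 1) (hb' : 0 < j → |b| < 1)
    (hα0 : 0 ≤ α) (hα1 : α ≤ 1) :
    -- the lattice consists of `2j + 2` distinct points
    Set.InjOn (ParaBannaiIto.grid j a b) (Set.Iic (2 * j + 1)) ∧
    -- it is obtained by adding `ρ₁` to the zeros of `P⁽⁰⁾_{2j+1}`
    (ParaBannaiIto.P0 j a b α (2 * j + 1) =
        ∏ s ∈ Finset.range (2 * j + 1),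
          (Polynomial.X - Polynomial.C (ParaBannaiIto.grid j a b s)) ∧
      ParaBannaiIto.grid j a b (2 * j + 1) = ParaBannaiIto.rho1 j a b ∧
      ParaBannaiIto.P1 j a b α (2 * j + 2) =
        ∏ s ∈ Finset.range (2 * j + 2),
          (Polynomial.X - Polynomial.C (ParaBannaiIto.grid j a b s))) ∧
    -- the quadri-lattice form of the points
    ((∀ s : ℕ, s ≤ j / 2 →
        ParaBannaiIto.grid j a b (4 * s) = -((4 * s - j - b + a) / 4) - 1 / 4 ∧
        ParaBannaiIto.grid j a b (4 * s + 1) = -((4 * s - j - b - a) / 4) - 1 / 4) ∧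
      (∀ s : ℕ, s < j / 2 →
        ParaBannaiIto.grid j a b (4 * s + 2) = (4 * s + 2 - j - b + a) / 4 - 1 / 4 ∧
        ParaBannaiIto.grid j a b (4 * s + 3) = (4 * s + 2 - j - b - a) / 4 - 1 / 4)) ∧
    -- none of the denominators of the weights vanishes
    ((∀ s : ℕ, s ≤ j / 2 →
        ParaBannaiIto.poch (-s) s * ParaBannaiIto.poch 1 (j / 2 - s) *
          ParaBannaiIto.poch (-s - a / 2) (j / 2 + 1) *
          ParaBannaiIto.poch (s + (1 + a - b - j) / 2) (j / 2) *
          ParaBannaiIto.poch (s + (1 - b - j) / 2) (j / 2) ≠ 0 ∧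
        ParaBannaiIto.poch (-s) s * ParaBannaiIto.poch 1 (j / 2 - s) *
          ParaBannaiIto.poch (-s + a / 2) (j / 2 + 1) *
          ParaBannaiIto.poch (s + (1 - a - b - j) / 2) (j / 2) *
          ParaBannaiIto.poch (s + (1 - b - j) / 2) (j / 2) ≠ 0) ∧
      (∀ s : ℕ, s < j / 2 →
        ParaBannaiIto.poch (-s) s * ParaBannaiIto.poch 1 (j / 2 - s - 1) *
          ParaBannaiIto.poch (-s - a / 2) (j / 2) *
          ParaBannaiIto.poch (s + (1 + a - b - j) / 2) (j / 2 + 1) *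
          ParaBannaiIto.poch (s + (1 - b - j) / 2) (j / 2 + 1) ≠ 0 ∧
        ParaBannaiIto.poch (-s) s * ParaBannaiIto.poch 1 (j / 2 - s - 1) *
          ParaBannaiIto.poch (-s + a / 2) (j / 2) *
          ParaBannaiIto.poch (s + (1 - a - b - j) / 2) (j / 2 + 1) *
          ParaBannaiIto.poch (s + (1 - b - j) / 2) (j / 2 + 1) ≠ 0)) ∧
    -- the orthogonality relation with the explicit weights
    (∀ n m : ℕ, n ≤ 2 * j + 1 → m ≤ 2 * j + 1 →
      ∑ s ∈ Finset.range (2 * j + 2), ParaBannaiIto.weight j a b α s *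
          (ParaBannaiIto.P1 j a b α n).eval (ParaBannaiIto.grid j a b s) *
          (ParaBannaiIto.P1 j a b α m).eval (ParaBannaiIto.grid j a b s) =
        if n = m then ParaBannaiIto.uProd j a b α n else 0) ∧
    -- the explicit norms
    (∀ n : ℕ, n ≤ 2 * j + 1 →
      ParaBannaiIto.hNorm j a b α n ^ 2 = ParaBannaiIto.uProd j a b α n) ∧
    ParaBannaiIto.hTop j a b ^ 2 = ParaBannaiIto.uProd j a b (1 / 2) (2 * j + 1) ∧
    -- positivity, and the general form of the weights, in the nondegenerate case
    (0 < α → α < 1 →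
      (∀ n : ℕ, 1 ≤ n → n ≤ 2 * j + 1 → 0 < ParaBannaiIto.u j a b α n) ∧
      (∀ s : ℕ, s ≤ 2 * j + 1 →
        0 < ParaBannaiIto.weight j a b α s ∧
        (ParaBannaiIto.P1 j a b α (2 * j + 1)).eval (ParaBannaiIto.grid j a b s) *
          (Polynomial.derivative (ParaBannaiIto.P1 j a b α (2 * j + 2))).eval
            (ParaBannaiIto.grid j a b s) ≠ 0 ∧
        ParaBannaiIto.weight j a b α s =
          ParaBannaiIto.uProd j a b α (2 * j + 1) /
            ((ParaBannaiIto.P1 j a b α (2 * j + 1)).eval (ParaBannaiIto.grid j a b s) *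
              (Polynomial.derivative (ParaBannaiIto.P1 j a b α (2 * j + 2))).eval
                (ParaBannaiIto.grid j a b s)))) := by
  obtain ⟨h, rfl⟩ := hj.exists_two_nsmul
  simp only [smul_eq_mul] at *
  have ha' : (2 * h : ℝ) + 1 ≤ |a| := by push_cast at ha; exact ha
  have hb'' : 0 < h → |b| < 1 := fun hh => hb' (by omega)
  have hneg : (2 * h : ℝ) + 1 ≤ |-a| := by rwa [abs_neg]
  have e1 : 2 * (2 * h) + 1 = 4 * h + 1 := by ring
  have e2 : 2 * (2 * h) + 2 = 4 * h + 2 := by ring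
  have e3 : 2 * h / 2 = h := by omega
  rw [e1, e2, e3]
  refine ⟨?_, ⟨ParaBannaiIto.P0_top_eq_prod ha' hb'', ParaBannaiIto.grid_last h a b,
    ParaBannaiIto.P1_top_eq_prod ha' hb''⟩, ⟨fun s _ => ⟨?_, ?_⟩, fun s _ => ⟨?_, ?_⟩⟩,
    ⟨fun s hs => ⟨?_, ?_⟩, fun s hs => ⟨?_, ?_⟩⟩,
    fun n m hn hm => ParaBannaiIto.orthogonality ha' hb'' hn hm,
    fun n hn => ParaBannaiIto.hNorm_sq ha' hb'' hα0 hα1 hn, ParaBannaiIto.hTop_sq ha' hb'',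
    fun h0 h1 => ⟨fun n hn hn' => ?_, fun s hs => ?_⟩⟩
  · exact (ParaBannaiIto.grid_injOn ha' hb'').mono fun k hk =>
      Finset.mem_coe.2 (Finset.mem_range.2 (Nat.lt_succ_of_le hk))
  · rw [ParaBannaiIto.grid_four_mul]; push_cast; ring
  · rw [ParaBannaiIto.grid_four_mul_add_one]; push_cast; ring
  · rw [ParaBannaiIto.grid_four_mul_add_two]; push_cast; ring
  · rw [ParaBannaiIto.grid_four_mul_add_three]; push_cast; ring
  · have := ParaBannaiIto.denominator_first_ne_zero hneg hb'' hs
    rw [neg_div, ← sub_eq_add_neg, sub_neg_eq_add] at this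
    push_cast; exact this
  · have := ParaBannaiIto.denominator_first_ne_zero ha' hb'' hs
    push_cast; exact this
  · have := ParaBannaiIto.denominator_second_ne_zero hneg hb'' hs
    rw [neg_div, ← sub_eq_add_neg, sub_neg_eq_add] at this
    push_cast; exact this
  · have := ParaBannaiIto.denominator_second_ne_zero ha' hb'' hs
    push_cast; exact this
  · obtain ⟨m, rfl⟩ := Nat.exists_eq_add_of_le' hn
    exact ParaBannaiIto.coeff_pos ha' hb'' h0 h1 (by omega)
  · have hs' : s < 4 * h + 2 := by omega
    obtain ⟨hd, hw⟩ := ParaBannaiIto.weight_eq (α := α) ha' hb'' hs'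
    have hm := ParaBannaiIto.eval_top_mul_mirror (α := α) ha' hb'' hs'
    have hu := (ParaBannaiIto.uProd_pos ha' hb'' h0 h1 (le_refl (4 * h + 1))).ne'
    rw [← hm] at hu
    have hp := left_ne_zero_of_mul hu
    refine ⟨ParaBannaiIto.weight_pos ha' hb'' h0 h1 hs', mul_ne_zero hp hd, ?_⟩
    -- For `0 < α < 1` the top norm is nonzero, so `P1` of degree `N` does not vanish at the node
    -- and may be inserted in numerator and denominator.
    rw [hw, ← hm, mul_div_mul_left _ _ hp]
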